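/- **Setting.** Let $(\mathcal X,d_{\mathcal X})$ be a metric space with its Borel $\sigma$-algebra, a base measure $\mu$ and a measurable density $p$, and let $d\ge 2$ be an integer. Assume, for positive constants $p_{\min},p_{\max},c_1,c_2,r_0,L_{\min},L_{\max}$: 1. $p_{\min}<p(x)<p_{\max}$ for all $x\in\mathcal X$; 2. $c_1\rho^d\le\mu(B_\rho(x))\le c_2\rho^d$ for all $x\in\mathcal X$ and $0<\rho<r_0$, where $B_\rho(x)$ is the closed ball; 3. there is a homeomorphism $h:\mathcal X\to[0,1]^d$ with $L_{\min}d_{\mathcal X}(x,x')\le\|h(x)-h(x')\|_2\le L_{\max}d_{\mathcal X}(x,x')$ for all $x,x'\in\mathcal X$. For $f_0:\mathcal X\to\mathbb R$ we observe $y_i=f_0(x_i)+\varepsilon_i$, $i=1,\dots,n$, where $x_1,\dots,x_n$ are i.i.d. with density $p$ with respect to $\mu$; $\varepsilon_1,\dots,\varepsilon_n$ are i.i.d. with $\mathbb E\varepsilon_i=0$ and $\mathbb P(|\varepsilon_i|>t)\le C e^{-t^2/(2\sigma^2)}$ for all $t>0$ ($C,\sigma>0$ constants); and $(\varepsilon_i)_i$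 is independent of $(x_i)_i$. Put $\theta^*_i=f_0(x_i)$ and $\|v\|_n^2=n^{-1}\sum_{i=1}^n v_i^2$. For a graph $G$ on $\{1,\dots,n\}$ with oriented incidence matrix $\nabla_G$ (so that $\|\nabla_G\theta\|_1=\sum_{\{i,j\}\in E(G)}|\theta_i-\theta_j|$) and $\lambda>0$, the fused lasso estimator is $$\hat\theta=\operatorname*{arg\,min}_{\theta\in\mathbb R^n}\Big\{\tfrac12\|y-\theta\|_2^2+\lambda\|\nabla_G\theta\|_1\Big\}.$$ In the $K$-NN graph $G_K$, $i\ne j$ are joined iff $x_i$ is among the $K$ nearest neighbours of $x_j$ among the other sample points, or vice versa (ties broken arbitrarily). In the $\epsilon$-NN graph $G_\epsilon$, $i\neq j$ are joined iff $d_{\mathcal X}(x_i,x_j)<\epsilon$. **Theorem.** Let $r>0$. (a) Let $K=K_n\asymp\log^{1+2r}n$. There are deterministic $\lambda_n>0$, depending only on $n$, the sequence $K$, $r$ and the constants $d,p_{\min},p_{\max},c_1,c_2,r_0,L_{\min},L_{\max},\sigma,C$, such that the $K$-NN fused lasso estimator ($G=G_{K_n}$, $\lambda=\lambda_n$) satisfies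 $$\|\hat\theta-\theta^*\|_n^2=O_{\mathbb P}\Big(\frac{\log^{1+2r}n}{n}+\frac{\log^{1.5+r}n}{n}\,\|\nabla_{G_K}\theta^*\|_1\Big).$$ (b) Let $\epsilon=\epsilon_n$ satisfy $\epsilon_n\ge a\,(\log^{1+2r}n/n)^{1/d}$ for some $a>0$ and all large $n$ (for instance $\epsilon_n\asymp\log^{1+2r}n/n^{1/d}$). There are deterministic $\lambda_n>0$, depending only on $n$, the sequence $\epsilon$, $r$ and the same constants, such that the $\epsilon$-NN fused lasso estimator ($G=G_{\epsilon_n}$, $\lambda=\lambda_n$) satisfies $$\|\hat\theta-\theta^*\|_n^2=O_{\mathbb P}\Big(\frac{\log^{1+2r}n}{n}+\frac{\log^{1.5+r}n}{n}\,\|\nabla_{G_\epsilon}\theta^*\|_1\Big).$$ Here $O_{\mathbb P}$ means: for every $\eta>0$ there are $M>0$ and $n_0$ such that for all $n\ge n_0$ the left side exceeds $M$ times the bracket with probability at most $\eta$. Both $M$ and $n_0$ depend only on $\eta$ and the quantities on which $\lambda_n$ is allowed to depend in the respective part (other than $n$), and not on $\mathcal X,\mu,p,f_0$, the error distribution, or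 the tie-breaking. -/

import Mathlib

open MeasureTheory ProbabilityTheory Filter Asymptotics

noncomputable section

namespace KNNFusedLasso

/-! ### Graphs on the sample points -/

/-- `S` is a set of `K` nearest neighbours of the point `x j` among the other points `x i`, `i ≠ j`
(all the other points if there are fewer than `K` of them). Ties in the distances may be broken in
any way. -/
def IsNearestNeighborSet {X : Type*} [MetricSpace X] {n : ℕ} (x : Fin n → X) (K : ℕ) (j : Fin n)
    (S : Finset (Fin n)) : Prop :=
  j ∉ S ∧ S.card = min K (n - 1) ∧
    ∀ i ∈ S, ∀ l, l ∉ S → l ≠ j → dist (x i) (x j) ≤ dist (x l) (x j)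

theorem exists_isNearestNeighborSet {X : Type*} [MetricSpace X] {n : ℕ} (x : Fin n → X) (K : ℕ)
    (j : Fin n) : ∃ S, IsNearestNeighborSet x K j S := by
  have key : ∀ k, k ≤ n - 1 → ∃ S : Finset (Fin n), j ∉ S ∧ S.card = k ∧
      ∀ i ∈ S, ∀ l, l ∉ S → l ≠ j → dist (x i) (x j) ≤ dist (x l) (x j) := by
    intro k
    induction k with
    | zero => exact fun _ => ⟨∅, by simp⟩
    | succ k ih =>
      intro hk
      obtain ⟨S, hj, hc, hS⟩ := ih (by omega)
      have hne : ((insert j S)ᶜ : Finset (Fin n)).Nonempty := by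
        rw [← Finset.card_pos, Finset.card_compl, Finset.card_insert_of_notMem hj, Fintype.card_fin]
        omega
      obtain ⟨m, hm, hmin⟩ := Finset.exists_min_image _ (fun i => dist (x i) (x j)) hne
      simp only [Finset.mem_compl, Finset.mem_insert, not_or] at hm hmin
      refine ⟨insert m S, ?_, ?_, ?_⟩
      · simp [hj, Ne.symm hm.1]
      · rw [Finset.card_insert_of_notMem hm.2, hc]
      · intro i hi l hl hlj
        simp only [Finset.mem_insert, not_or] at hi hl
        rcases hi with rfl | hi
        · exact hmin l ⟨hlj, hl.2⟩
        · exact hS i hi l hl.2 hlj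
  exact key _ (min_le_right _ _)

/-- `G` is a `K`-nearest-neighbour graph of the points `x`: `i` and `j` are joined if and only if
`x i` is among the `K` nearest neighbours of `x j`, or vice versa. -/
def IsKNNGraph {X : Type*} [MetricSpace X] {n : ℕ} (x : Fin n → X) (K : ℕ)
    (G : SimpleGraph (Fin n)) : Prop :=
  ∃ N : Fin n → Finset (Fin n), (∀ j, IsNearestNeighborSet x K j (N j)) ∧
    ∀ i j, G.Adj i j ↔ (i ∈ N j ∨ j ∈ N i)

theorem exists_isKNNGraph {X : Type*} [MetricSpace X] {n : ℕ} (x : Fin n → X) (K : ℕ) :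
    ∃ G, IsKNNGraph x K G := by
  choose N hN using exists_isNearestNeighborSet x K
  refine ⟨⟨fun i j => i ∈ N j ∨ j ∈ N i, ⟨fun i j h => h.symm⟩, ⟨fun i h => ?_⟩⟩,
    N, hN, fun i j => Iff.rfl⟩
  rcases h with h | h <;> exact (hN i).1 h

/-- The `ε`-nearest-neighbour graph of the points `x`. -/
def epsGraph {X : Type*} [MetricSpace X] {n : ℕ} (x : Fin n → X) (ε : ℝ) :
    SimpleGraph (Fin n) where
  Adj i j := i ≠ j ∧ dist (x i) (x j) < ε
  symm := ⟨fun i j h => ⟨h.1.symm, by rw [dist_comm]; exact h.2⟩⟩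
  loopless := ⟨fun _ h => h.1 rfl⟩

/-- The edges of `G`, each listed once, with its orientation from the smaller to the larger
endpoint. -/
abbrev OrientedEdge {n : ℕ} (G : SimpleGraph (Fin n)) : Type :=
  {e : Fin n × Fin n // e.1 < e.2 ∧ G.Adj e.1 e.2}

instance {n : ℕ} (G : SimpleGraph (Fin n)) : Fintype (OrientedEdge G) := Fintype.ofFinite _

/-- The oriented incidence matrix `∇_G`; its rows are indexed by the edges of `G`. -/
def incidence {n : ℕ} (G : SimpleGraph (Fin n)) : Matrix (OrientedEdge G) (Fin n) ℝ :=
  fun e l => if l = e.1.1 then 1 else if l = e.1.2 then -1 else 0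

/-- The total variation `‖∇_G θ‖₁` of a signal `θ` along the graph `G`. -/
def graphTV {n : ℕ} (G : SimpleGraph (Fin n)) (θ : Fin n → ℝ) : ℝ :=
  ∑ e, |(incidence G).mulVec θ e|

theorem incidence_mulVec {n : ℕ} (G : SimpleGraph (Fin n)) (θ : Fin n → ℝ) (e : OrientedEdge G) :
    (incidence G).mulVec θ e = θ e.1.1 - θ e.1.2 := by
  have hne : e.1.2 ≠ e.1.1 := e.2.1.ne'
  have h : ∀ l, incidence G e l * θ l
      = (if l = e.1.1 then θ l else 0) - (if l = e.1.2 then θ l else 0) := by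
    intro l
    unfold incidence
    by_cases h1 : l = e.1.1
    · have h2 : l ≠ e.1.2 := fun h => hne (h.symm.trans h1)
      simp [h1, hne.symm]
    · by_cases h2 : l = e.1.2 <;> simp [h1, h2, hne]
  simp only [Matrix.mulVec, dotProduct, h, Finset.sum_sub_distrib]
  simp

/-! ### The fused lasso -/

/-- The fused lasso objective `½ ‖y - θ‖₂² + lam ‖∇_G θ‖₁`. -/
def objective {n : ℕ} (y : Fin n → ℝ) (G : SimpleGraph (Fin n)) (lam : ℝ) (θ : Fin n → ℝ) : ℝ :=
  1 / 2 * ∑ i, (y i - θ i) ^ 2 + lam * graphTV G θ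

/-- `θ` is the fused lasso estimator: it minimizes the objective over `ℝⁿ`. For `lam ≥ 0` the
objective is continuous, coercive and strictly convex, so there is exactly one such `θ`. -/
def IsFusedLasso {n : ℕ} (y : Fin n → ℝ) (G : SimpleGraph (Fin n)) (lam : ℝ) (θ : Fin n → ℝ) :
    Prop :=
  ∀ θ' : Fin n → ℝ, objective y G lam θ ≤ objective y G lam θ'

theorem exists_isFusedLasso {n : ℕ} (y : Fin n → ℝ) (G : SimpleGraph (Fin n)) {lam : ℝ}
    (hlam : 0 ≤ lam) : ∃ θ, IsFusedLasso y G lam θ := by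
  have hcont : Continuous (objective y G lam) := by
    unfold objective graphTV
    simp only [incidence_mulVec]
    fun_prop
  have hTV : ∀ θ, 0 ≤ graphTV G θ := fun θ => Finset.sum_nonneg fun _ _ => abs_nonneg _
  -- outside the closed ball of radius `R` about `y` the objective exceeds its value at `y`
  set R : ℝ := 1 + 2 * objective y G lam y with hR
  have h0 : 0 ≤ objective y G lam y := by
    have := mul_nonneg hlam (hTV y)
    have : 0 ≤ ∑ i, (y i - y i) ^ 2 := Finset.sum_nonneg fun _ _ => sq_nonneg _
    unfold objective
    linarith
  obtain ⟨θ, -, hmin⟩ := (isCompact_closedBall y R).exists_isMinOn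
    ⟨y, Metric.mem_closedBall_self (by linarith)⟩ hcont.continuousOn
  refine ⟨θ, fun θ' => ?_⟩
  by_cases hθ : θ' ∈ Metric.closedBall y R
  · exact hmin hθ
  · refine (hmin (Metric.mem_closedBall_self (by linarith))).trans ?_
    have : ∃ i, R < |θ' i - y i| := by
      by_contra! hcon
      exact hθ ((dist_pi_le_iff (by linarith)).2 fun i => by rw [Real.dist_eq]; exact hcon i)
    obtain ⟨i, hi⟩ := this
    have h1 : (y i - θ' i) ^ 2 ≤ ∑ i, (y i - θ' i) ^ 2 :=
      Finset.single_le_sum (f := fun i => (y i - θ' i) ^ 2) (fun _ _ => sq_nonneg _)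
        (Finset.mem_univ i)
    have h2 : R ^ 2 ≤ (y i - θ' i) ^ 2 := by
      rw [← sq_abs (y i - θ' i), abs_sub_comm]
      exact pow_le_pow_left₀ (by linarith) hi.le 2
    have h3 := mul_nonneg hlam (hTV θ')
    have h4 : objective y G lam θ' = 1 / 2 * ∑ i, (y i - θ' i) ^ 2 + lam * graphTV G θ' := rfl
    nlinarith

theorem IsFusedLasso.unique {n : ℕ} {y : Fin n → ℝ} {G : SimpleGraph (Fin n)} {lam : ℝ}
    (hlam : 0 ≤ lam) {θ θ' : Fin n → ℝ} (h : IsFusedLasso y G lam θ)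
    (h' : IsFusedLasso y G lam θ') : θ = θ' := by
  have hm := h fun i => (θ i + θ' i) / 2
  have hm' := h' fun i => (θ i + θ' i) / 2
  have hTV : graphTV G (fun i => (θ i + θ' i) / 2) ≤ (graphTV G θ + graphTV G θ') / 2 := by
    unfold graphTV
    rw [← Finset.sum_add_distrib, Finset.sum_div]
    refine Finset.sum_le_sum fun e _ => ?_
    simp only [incidence_mulVec]
    rw [show (θ e.1.1 + θ' e.1.1) / 2 - (θ e.1.2 + θ' e.1.2) / 2
      = ((θ e.1.1 - θ e.1.2) + (θ' e.1.1 - θ' e.1.2)) / 2 by ring, abs_div, abs_two]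
    gcongr
    exact abs_add_le _ _
  have hsq : ∑ i, (y i - (θ i + θ' i) / 2) ^ 2 = (∑ i, (y i - θ i) ^ 2) / 2
      + (∑ i, (y i - θ' i) ^ 2) / 2 - (∑ i, (θ i - θ' i) ^ 2) / 4 := by
    rw [Finset.sum_div, Finset.sum_div, Finset.sum_div, ← Finset.sum_add_distrib,
      ← Finset.sum_sub_distrib]
    exact Finset.sum_congr rfl fun i _ => by ring
  have hl := mul_le_mul_of_nonneg_left hTV hlam
  unfold objective at hm hm'
  rw [hsq] at hm hm'
  have hz : ∑ i, (θ i - θ' i) ^ 2 ≤ 0 := by nlinarith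
  have hz' := le_antisymm hz (Finset.sum_nonneg fun _ _ => sq_nonneg _)
  rw [Finset.sum_eq_zero_iff_of_nonneg fun _ _ => sq_nonneg _] at hz'
  funext i
  have := hz' i (Finset.mem_univ i)
  exact sub_eq_zero.1 (pow_eq_zero_iff (two_ne_zero) |>.1 this)

/-- The squared empirical norm `‖v‖ₙ² = n⁻¹ ∑ᵢ vᵢ²`. -/
def empNormSq {n : ℕ} (v : Fin n → ℝ) : ℝ :=
  (n : ℝ)⁻¹ * ∑ i, v i ^ 2

/-! ### The statistical model -/

/-- The cube `[0,1]^d` as a subset of Euclidean space. -/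
def unitCube (d : ℕ) : Set (EuclideanSpace ℝ (Fin d)) :=
  {z | ∀ i, 0 ≤ z i ∧ z i ≤ 1}

/-- The numerical constants of the model. -/
structure Constants where
  /-- intrinsic dimension -/
  d : ℕ
  /-- bounds on the density -/
  pmin : ℝ
  pmax : ℝ
  /-- volume growth of balls of radius less than `r0` -/
  c1 : ℝ
  c2 : ℝ
  r0 : ℝ
  /-- bi-Lipschitz constants of the homeomorphism onto the cube -/
  Lmin : ℝ
  Lmax : ℝ
  /-- sub-Gaussian constants of the errors -/
  σ : ℝ
  C : ℝ
  two_le_d : 2 ≤ d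
  pmin_pos : 0 < pmin
  c1_pos : 0 < c1
  c2_pos : 0 < c2
  r0_pos : 0 < r0
  Lmin_pos : 0 < Lmin
  Lmax_pos : 0 < Lmax
  σ_pos : 0 < σ
  C_pos : 0 < C

/-- The assumptions on the covariate space `X`, its base measure `μ` and the density `p`. -/
structure DesignAssumptions (c : Constants) {X : Type*} [MetricSpace X] [MeasurableSpace X]
    (μ : Measure X) (p : X → ℝ) : Prop where
  measurable_density : Measurable p
  bounded_density : ∀ t, c.pmin < p t ∧ p t < c.pmax
  ball_volume : ∀ (t : X) (ρ : ℝ), 0 < ρ → ρ < c.r0 →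
    ENNReal.ofReal (c.c1 * ρ ^ c.d) ≤ μ (Metric.closedBall t ρ) ∧
      μ (Metric.closedBall t ρ) ≤ ENNReal.ofReal (c.c2 * ρ ^ c.d)
  exists_homeomorph : ∃ h : X ≃ₜ unitCube c.d, ∀ t t' : X,
    c.Lmin * dist t t' ≤ ‖(h t : EuclideanSpace ℝ (Fin c.d)) - h t'‖ ∧
      ‖(h t : EuclideanSpace ℝ (Fin c.d)) - h t'‖ ≤ c.Lmax * dist t t'

/-- The covariates `x i` are i.i.d. with density `p` with respect to `μ`; the errors `ξ i` are
i.i.d., centred and sub-Gaussian; the errors are independent of the covariates. -/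
structure SampleAssumptions (c : Constants) {X : Type*} [MeasurableSpace X]
    (μ : Measure X) (p : X → ℝ) {Ω : Type*} [MeasurableSpace Ω] (P : Measure Ω) {n : ℕ}
    (x : Fin n → Ω → X) (ξ : Fin n → Ω → ℝ) : Prop where
  measurable_covariate : ∀ i, Measurable (x i)
  law_covariate : ∀ i, P.map (x i) = μ.withDensity (fun t => ENNReal.ofReal (p t))
  indep_covariates : iIndepFun x P
  measurable_error : ∀ i, Measurable (ξ i)
  identDistrib_errors : ∀ i j, IdentDistrib (ξ i) (ξ j) P P
  indep_errors : iIndepFun ξ P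
  integrable_error : ∀ i, Integrable (ξ i) P
  mean_zero : ∀ i, ∫ ω, ξ i ω ∂P = 0
  sub_gaussian : ∀ i, ∀ t : ℝ, 0 < t →
    P {ω | t < |ξ i ω|} ≤ ENNReal.ofReal (c.C * Real.exp (-t ^ 2 / (2 * c.σ ^ 2)))
  indep_errors_covariates : IndepFun (fun ω i => ξ i ω) (fun ω i => x i ω) P

/-- The rate `log^{1+2r} n / n + (log^{1.5+r} n / n) · TV`. -/
def rate (r : ℝ) (n : ℕ) (TV : ℝ) : ℝ :=
  Real.log n ^ (1 + 2 * r) / n + Real.log n ^ (3 / 2 + r) / n * TV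

end KNNFusedLasso

end

/-!
The proof compares the nearest-neighbour graphs with a grid and controls the noise by a dyadic
multiscale argument.

Cut the cube into `2 ^ (d J)` dyadic cells, with `J` chosen so that a cell holds about
`log ^ (1 + 2 r) n` sample points (`eventually_exists_scale`). Since this number is large compared
with `log n`, Chernoff's bound shows that all cell counts are of this order at once
(`measure_card_filter_le`). If the cells are a small constant times the scale of the graph, then
both nearest-neighbour graphs join any two sample points in equal or adjacent cells
(`joinsNearbyCells_of_isKNNGraph`, `dist_le_of_nearby_cells`); nothing else about the graphs is
used.

By the basic inequality for the minimizer (`sum_sq_sub_le_of_isFusedLasso`) it suffices to bound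
`∑ ξ i * Δ i`, where `Δ` is the estimation error, by `lam ‖∇_G Δ‖₁` plus a multiple of `‖Δ‖₂`.
Replacing `Δ` by its cell averages `A` costs a multiple of `‖∇_G Δ‖₁`, and the total variation of
`A` along the grid is at most a multiple of `‖∇_G Δ‖₁` (`sum_abs_sub_cellAvg_le`,
`dirTV_cellAvg_le`). The remaining pairing of the block sums of the noise with `A` is resolved by
merging cells in pairs, one coordinate at a time, in cyclic order (`abs_sum_box_mul_le`). One merge
contributes the sums of the noise over the blocks of the current stage times the differences of
the averages of sibling blocks, and the latter add up to at most the total variation in the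
direction of the merge. At stage `s` a block sum is of order `2 ^ (s / 2)`, while the total
variation in a fixed direction is halved by every merge along another direction
(`dirTV_mergeAvg_of_ne`) and does not grow by merges along its own (`dirTV_mergeAvg_self`); as
`d ≥ 2`, it decreases at least like `2 ^ (-s / 2)` (`dirTV_coarseAvg_le`). So each of the
`O(log n)` stages contributes the same, and the last stage, the product of the overall means, gives
the term with `‖Δ‖₂`.

The block sums are taken over random sets of indices, but these depend on the covariates only, so
conditionally on them Hoeffding's inequality applies (`measure_sqrt_card_lt_abs_sum_random_le`); a
union bound over the at most `n ^ 2` blocks costs a factor `√(log n)`. Because averages over cells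
are used, the penalty that the noise requires stays bounded (`required_penalty_le`), and
`log ^ (3/2 + r) n` dominates it for large `n`.
-/

namespace KNNFusedLasso

/-! ### Dyadic coarsening of functions on a grid -/

/-- The lower of the two grid indices that are merged into `b` when the grid is coarsened by a
factor of two along the coordinate `k`. -/
def lowerChild {d : ℕ} (k : Fin d) (b : Fin d → ℕ) : Fin d → ℕ := Function.update b k (2 * b k)

/-- The upper of the two grid indices that are merged into `b` when the grid is coarsened by a
factor of two along the coordinate `k`. -/
def upperChild {d : ℕ} (k : Fin d) (b : Fin d → ℕ) : Fin d → ℕ :=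
  Function.update b k (2 * b k + 1)

/-- The index of the merged cell that contains the cell `b` when the grid is coarsened along the
coordinate `k`. It is also applied to side lengths. -/
def halve {d : ℕ} (k : Fin d) (b : Fin d → ℕ) : Fin d → ℕ := Function.update b k (b k / 2)

/-- The neighbour of the cell `b` in the positive direction `k`. -/
def succAt {d : ℕ} (k : Fin d) (b : Fin d → ℕ) : Fin d → ℕ := Function.update b k (b k + 1)

/-- The grid with side lengths `L`. -/
def box {d : ℕ} (L : Fin d → ℕ) : Finset (Fin d → ℕ) :=
  Fintype.piFinset fun k => Finset.range (L k)

theorem mem_box {d : ℕ} {L b : Fin d → ℕ} : b ∈ box L ↔ ∀ k, b k < L k := by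
  simp [box]

theorem halve_eq_iff {d : ℕ} (k : Fin d) (z b : Fin d → ℕ) :
    halve k z = b ↔ z = lowerChild k b ∨ z = upperChild k b := by
  simp only [halve, lowerChild, upperChild, Function.update_eq_iff, Function.eq_update_iff]
  constructor
  · rintro ⟨h1, h2⟩
    have : z k = 2 * b k ∨ z k = 2 * b k + 1 := by omega
    exact this.imp (fun h => ⟨h, h2⟩) fun h => ⟨h, h2⟩
  · rintro (⟨h1, h2⟩ | ⟨h1, h2⟩) <;> exact ⟨by omega, h2⟩

theorem lowerChild_ne_upperChild {d : ℕ} (k : Fin d) (b : Fin d → ℕ) :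
    lowerChild k b ≠ upperChild k b := by
  intro h
  have := congrFun h k
  simp [lowerChild, upperChild] at this

theorem sum_box_eq_sum_children {d : ℕ} (k : Fin d) (L : Fin d → ℕ) (hL : Even (L k))
    (f : (Fin d → ℕ) → ℝ) :
    ∑ b ∈ box L, f b = ∑ b ∈ box (halve k L), (f (lowerChild k b) + f (upperChild k b)) := by
  obtain ⟨m, hm⟩ := hL
  have h1 : ∀ b, f (lowerChild k b) + f (upperChild k b)
      = ∑ i ∈ Finset.range 2, f (Function.update b k (2 * b k + i)) := by
    intro b
    simp [Finset.sum_range_succ, lowerChild, upperChild]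
  simp only [h1]
  rw [← Finset.sum_product' (box (halve k L)) (Finset.range 2)
    fun b i => f (Function.update b k (2 * b k + i))]
  refine Finset.sum_nbij' (fun b => (halve k b, b k % 2))
    (fun q => Function.update q.1 k (2 * q.1 k + q.2)) ?_ ?_ ?_ ?_ ?_
  · intro b hb
    rw [mem_box] at hb
    simp only [Finset.mem_product, mem_box, Finset.mem_range]
    refine ⟨fun j => ?_, Nat.mod_lt _ two_pos⟩
    by_cases hj : j = k
    · subst hj
      have := hb j
      simp only [halve, Function.update_self]
      omega
    · simpa [halve, hj] using hb j
  · rintro ⟨b, i⟩ hq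
    simp only [Finset.mem_product, mem_box, Finset.mem_range] at hq
    rw [mem_box]
    intro j
    by_cases hj : j = k
    · subst hj
      have := hq.1 j
      simp only [halve, Function.update_self] at this ⊢
      omega
    · simpa [halve, hj] using hq.1 j
  · intro b _
    simp only [halve, Function.update_self, Function.update_idem, Nat.div_add_mod,
      Function.update_eq_self]
  · rintro ⟨b, i⟩ hq
    simp only [Finset.mem_product, mem_box, Finset.mem_range] at hq
    simp only [halve, Function.update_self, Function.update_idem, Prod.mk.injEq]
    refine ⟨?_, by omega⟩
    rw [show (2 * b k + i) / 2 = b k by omega, Function.update_eq_self]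
  · intro b _
    simp only [halve, Function.update_self, Function.update_idem, Nat.div_add_mod,
      Function.update_eq_self]

/-- The total variation of `A` along the grid edges in direction `k`. -/
noncomputable def dirTV {d : ℕ} (k : Fin d) (L : Fin d → ℕ) (A : (Fin d → ℕ) → ℝ) : ℝ :=
  ∑ b ∈ box L, if b k + 1 < L k then |A b - A (succAt k b)| else 0

/-- The average of `A` over the two children of a cell. -/
noncomputable def mergeAvg {d : ℕ} (k : Fin d) (A : (Fin d → ℕ) → ℝ) (b : Fin d → ℕ) : ℝ :=
  (A (lowerChild k b) + A (upperChild k b)) / 2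

theorem dirTV_nonneg {d : ℕ} (k : Fin d) (L : Fin d → ℕ) (A : (Fin d → ℕ) → ℝ) :
    0 ≤ dirTV k L A :=
  Finset.sum_nonneg fun b _ => by split_ifs <;> positivity

theorem succAt_lowerChild {d : ℕ} (k : Fin d) (b : Fin d → ℕ) :
    succAt k (lowerChild k b) = upperChild k b := by
  simp [succAt, lowerChild, upperChild]

theorem succAt_upperChild {d : ℕ} (k : Fin d) (b : Fin d → ℕ) :
    succAt k (upperChild k b) = lowerChild k (succAt k b) := by
  simp only [succAt, lowerChild, upperChild, Function.update_self, Function.update_idem]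
  congr 1

theorem dirTV_eq_sum_children {d : ℕ} (k : Fin d) (L : Fin d → ℕ) (hL : Even (L k))
    (A : (Fin d → ℕ) → ℝ) :
    dirTV k L A = ∑ b ∈ box (halve k L), (|A (lowerChild k b) - A (upperChild k b)| +
      if b k + 1 < halve k L k then
        |A (upperChild k b) - A (lowerChild k (succAt k b))| else 0) := by
  rw [dirTV, sum_box_eq_sum_children k L hL]
  refine Finset.sum_congr rfl fun b hb => ?_
  have hbk := mem_box.1 hb k
  obtain ⟨m, hm⟩ := hL
  simp only [succAt_lowerChild, succAt_upperChild]
  have h2 : halve k L k = m := by simp [halve]; omega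
  rw [h2] at hbk ⊢
  have h3 : lowerChild k b k = 2 * b k := by simp [lowerChild]
  have h4 : upperChild k b k = 2 * b k + 1 := by simp [upperChild]
  rw [h3, h4, if_pos (by omega)]
  congr 1
  by_cases h : b k + 1 < m
  · rw [if_pos h, if_pos (by omega)]
  · rw [if_neg h, if_neg (by omega)]

theorem sum_abs_children_le {d : ℕ} (k : Fin d) (L : Fin d → ℕ) (hL : Even (L k))
    (A : (Fin d → ℕ) → ℝ) :
    ∑ b ∈ box (halve k L), |A (lowerChild k b) - A (upperChild k b)| ≤ dirTV k L A := by
  rw [dirTV_eq_sum_children k L hL]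
  refine Finset.sum_le_sum fun b _ => ?_
  have : 0 ≤ if b k + 1 < halve k L k then
    |A (upperChild k b) - A (lowerChild k (succAt k b))| else 0 := by split_ifs <;> positivity
  linarith

/-- Coarsening along `k` does not increase the total variation in direction `k`. -/
theorem dirTV_mergeAvg_self {d : ℕ} (k : Fin d) (L : Fin d → ℕ) (hL : Even (L k))
    (A : (Fin d → ℕ) → ℝ) : dirTV k (halve k L) (mergeAvg k A) ≤ dirTV k L A := by
  rw [dirTV_eq_sum_children k L hL]
  set u : (Fin d → ℕ) → ℝ := fun b => |A (lowerChild k b) - A (upperChild k b)| with hu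
  set v : (Fin d → ℕ) → ℝ := fun b => |A (upperChild k b) - A (lowerChild k (succAt k b))| with hv
  set B := (box (halve k L)).filter fun b => b k + 1 < halve k L k with hB
  have hinj : Set.InjOn (succAt k) (B : Set (Fin d → ℕ)) := by
    intro a _ b _ hab
    have h1 := congrFun hab
    funext j
    have := h1 j
    by_cases hj : j = k
    · subst hj
      simpa [succAt] using this
    · simpa [succAt, hj] using this
  have hshift : ∑ b ∈ B, u (succAt k b) ≤ ∑ b ∈ box (halve k L), u b := by
    rw [← Finset.sum_image hinj]
    refine Finset.sum_le_sum_of_subset_of_nonneg ?_ fun _ _ _ => abs_nonneg _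
    intro b hb
    obtain ⟨a, ha, rfl⟩ := Finset.mem_image.1 hb
    rw [hB, Finset.mem_filter, mem_box] at ha
    rw [mem_box]
    intro j
    by_cases hj : j = k
    · subst hj
      simpa [succAt] using ha.2
    · simpa [succAt, hj] using ha.1 j
  have hsub : ∑ b ∈ B, u b ≤ ∑ b ∈ box (halve k L), u b :=
    Finset.sum_le_sum_of_subset_of_nonneg (Finset.filter_subset _ _) fun _ _ _ => abs_nonneg _
  rw [Finset.sum_add_distrib, dirTV, ← Finset.sum_filter, ← Finset.sum_filter, ← hB]
  have hpt : ∀ b ∈ B, |mergeAvg k A b - mergeAvg k A (succAt k b)|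
      ≤ u b / 2 + v b + u (succAt k b) / 2 := by
    intro b _
    simp only [hu, hv, mergeAvg]
    rw [abs_le]
    have e1 := abs_le.1 (le_refl |A (lowerChild k b) - A (upperChild k b)|)
    have e2 := abs_le.1 (le_refl |A (upperChild k b) - A (lowerChild k (succAt k b))|)
    have e3 := abs_le.1
      (le_refl |A (lowerChild k (succAt k b)) - A (upperChild k (succAt k b))|)
    constructor <;> linarith [e1.1, e1.2, e2.1, e2.2, e3.1, e3.2]
  have := Finset.sum_le_sum hpt
  rw [Finset.sum_add_distrib, Finset.sum_add_distrib, ← Finset.sum_div, ← Finset.sum_div] at this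
  linarith

/-- Coarsening along `k` halves the total variation in every other direction. -/
theorem dirTV_mergeAvg_of_ne {d : ℕ} {j k : Fin d} (hjk : j ≠ k) (L : Fin d → ℕ)
    (hL : Even (L k)) (A : (Fin d → ℕ) → ℝ) :
    dirTV j (halve k L) (mergeAvg k A) ≤ dirTV j L A / 2 := by
  rw [dirTV, dirTV, sum_box_eq_sum_children k L hL, Finset.sum_div]
  refine Finset.sum_le_sum fun b _ => ?_
  have h1 : halve k L j = L j := by simp [halve, hjk]
  have h2 : lowerChild k b j = b j := by simp [lowerChild, hjk]
  have h3 : upperChild k b j = b j := by simp [upperChild, hjk]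
  have h4 : succAt j (lowerChild k b) = lowerChild k (succAt j b) := by
    simp only [succAt, lowerChild, Function.update_of_ne hjk, Function.update_of_ne hjk.symm]
    exact Function.update_comm hjk.symm _ _ _
  have h5 : succAt j (upperChild k b) = upperChild k (succAt j b) := by
    simp only [succAt, upperChild, Function.update_of_ne hjk, Function.update_of_ne hjk.symm]
    exact Function.update_comm hjk.symm _ _ _
  rw [h1, h2, h3, h4, h5]
  split_ifs
  · rw [mergeAvg, mergeAvg, ← sub_div, abs_div, abs_two, add_sub_add_comm]
    gcongr
    exact abs_add_le _ _
  · simp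

/-- The cell at stage `s` that contains the cell `z` of the original grid, when the `t`-th
coarsening is along the coordinate `dir t`. It is also applied to the side lengths of the grid. -/
def coarsen {d : ℕ} (dir : ℕ → Fin d) : ℕ → (Fin d → ℕ) → Fin d → ℕ
  | 0 => id
  | s + 1 => fun z => halve (dir s) (coarsen dir s z)

/-- The averages of `A` over the cells of stage `s`. -/
noncomputable def coarseAvg {d : ℕ} (dir : ℕ → Fin d) (A : (Fin d → ℕ) → ℝ) :
    ℕ → (Fin d → ℕ) → ℝ
  | 0 => A
  | s + 1 => mergeAvg (dir s) (coarseAvg dir A s)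

/-- If no two consecutive coarsenings are along the same coordinate, then at least every second
coarsening halves the total variation in a given direction. -/
theorem dirTV_coarseAvg_le {d : ℕ} {dir : ℕ → Fin d} (hdir : ∀ s, dir (s + 1) ≠ dir s) {N : ℕ}
    {L : Fin d → ℕ} (hL : ∀ s < N, Even (coarsen dir s L (dir s))) (A : (Fin d → ℕ) → ℝ)
    (k : Fin d) (s : ℕ) (hs : s ≤ N) :
    dirTV k (coarsen dir s L) (coarseAvg dir A s) * √2 ^ s ≤ √2 * dirTV k L A ∧
      (dir s = k →
        dirTV k (coarsen dir s L) (coarseAvg dir A s) * √2 ^ s ≤ dirTV k L A) := by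
  have h2 : √2 * √2 = 2 := Real.mul_self_sqrt (by norm_num)
  have h1 : 1 ≤ √2 := Real.one_le_sqrt.2 (by norm_num)
  induction s with
  | zero =>
    have := dirTV_nonneg k L A
    simp only [coarsen, coarseAvg, pow_zero, mul_one, id]
    exact ⟨by nlinarith, fun _ => le_rfl⟩
  | succ s ih =>
    obtain ⟨i1, i2⟩ := ih (by omega)
    have hE := hL s (by omega)
    simp only [coarsen, coarseAvg]
    rw [pow_succ]
    by_cases hk : dir s = k
    · have hm := dirTV_mergeAvg_self (dir s) _ hE (coarseAvg dir A s)
      rw [hk] at hm ⊢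
      refine ⟨?_, fun h => absurd (h.trans hk.symm) (hdir s)⟩
      calc _ ≤ dirTV k (coarsen dir s L) (coarseAvg dir A s) * (√2 ^ s * √2) := by gcongr
        _ = √2 * (dirTV k (coarsen dir s L) (coarseAvg dir A s) * √2 ^ s) := by ring
        _ ≤ _ := by gcongr; exact i2 hk
    · have hm := dirTV_mergeAvg_of_ne (Ne.symm hk) _ hE (coarseAvg dir A s)
      have key : dirTV k (halve (dir s) (coarsen dir s L)) (mergeAvg (dir s) (coarseAvg dir A s))
          * (√2 ^ s * √2) ≤ dirTV k L A := by
        calc _ ≤ dirTV k (coarsen dir s L) (coarseAvg dir A s) / 2 * (√2 ^ s * √2) := by gcongr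
          _ = (dirTV k (coarsen dir s L) (coarseAvg dir A s) * √2 ^ s) * √2 / 2 := by ring
          _ ≤ (√2 * dirTV k L A) * √2 / 2 := by gcongr
          _ = dirTV k L A * (√2 * √2) / 2 := by ring
          _ = dirTV k L A := by rw [h2]; ring
      have := dirTV_nonneg k L A
      exact ⟨by nlinarith, fun _ => key⟩

/-- One coarsening step in the pairing of block sums with block averages: what is lost is the
product of the differences between siblings. -/
theorem sum_box_mul_eq {d : ℕ} (k : Fin d) (L : Fin d → ℕ) (hL : Even (L k))
    (S A : (Fin d → ℕ) → ℝ) :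
    ∑ b ∈ box L, S b * A b
      = ∑ b ∈ box (halve k L), (S (lowerChild k b) + S (upperChild k b)) * mergeAvg k A b
        + ∑ b ∈ box (halve k L), (S (lowerChild k b) - S (upperChild k b)) / 2
          * (A (lowerChild k b) - A (upperChild k b)) := by
  rw [sum_box_eq_sum_children k L hL, ← Finset.sum_add_distrib]
  refine Finset.sum_congr rfl fun b _ => ?_
  rw [mergeAvg]
  ring

/-- The multiscale bound: if the block sums at stage `s` are at most `τ √2 ^ s`, which is their
typical size when they consist of independent terms, then the pairing of `S` with `A` is
controlled by the total variation of `A` along the grid, up to the contribution of the last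
stage. -/
theorem abs_sum_box_mul_le {d : ℕ} {dir : ℕ → Fin d} (hdir : ∀ s, dir (s + 1) ≠ dir s) (N : ℕ)
    {L : Fin d → ℕ} (hL : ∀ s < N, Even (coarsen dir s L (dir s))) (A : (Fin d → ℕ) → ℝ)
    (S : ℕ → (Fin d → ℕ) → ℝ)
    (hS : ∀ s b, S (s + 1) b = S s (lowerChild (dir s) b) + S s (upperChild (dir s) b))
    {τ : ℝ} (hτ : ∀ s < N, ∀ b, |S s b| ≤ τ * √2 ^ s) :
    |∑ b ∈ box L, S 0 b * A b| ≤ τ * ∑ s ∈ Finset.range N, dirTV (dir s) L A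
      + |∑ b ∈ box (coarsen dir N L), S N b * coarseAvg dir A N b| := by
  induction N with
  | zero => simp [coarsen, coarseAvg]
  | succ N ih =>
    refine (ih (fun s hs => hL s (by omega)) (fun s hs => hτ s (by omega))).trans ?_
    rw [Finset.sum_range_succ, mul_add, add_assoc]
    gcongr
    have hE := hL N (by omega)
    rw [sum_box_mul_eq (dir N) _ hE]
    simp only [← hS]
    refine (abs_add_le _ _).trans ?_
    rw [add_comm]
    refine add_le_add ?_ le_rfl
    have hτ0 : 0 ≤ τ * √2 ^ N := (abs_nonneg _).trans (hτ N (by omega) fun _ => 0)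
    have hT := (dirTV_coarseAvg_le hdir hL A (dir N) N (by omega)).2 rfl
    have hτ1 : 0 ≤ τ := nonneg_of_mul_nonneg_left hτ0 (by positivity)
    calc _ ≤ ∑ b ∈ box (halve (dir N) (coarsen dir N L)), τ * √2 ^ N *
          |coarseAvg dir A N (lowerChild (dir N) b)
            - coarseAvg dir A N (upperChild (dir N) b)| := by
          refine (Finset.abs_sum_le_sum_abs _ _).trans (Finset.sum_le_sum fun b _ => ?_)
          rw [abs_mul]
          gcongr
          rw [abs_div, abs_two]
          have h1 := hτ N (by omega) (lowerChild (dir N) b)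
          have h2 := hτ N (by omega) (upperChild (dir N) b)
          have h3 := abs_sub (S N (lowerChild (dir N) b)) (S N (upperChild (dir N) b))
          linarith
      _ ≤ τ * √2 ^ N * dirTV (dir N) (coarsen dir N L) (coarseAvg dir A N) := by
          rw [← Finset.mul_sum]
          gcongr
          exact sum_abs_children_le _ _ hE _
      _ = τ * (dirTV (dir N) (coarsen dir N L) (coarseAvg dir A N) * √2 ^ N) := by ring
      _ ≤ _ := by gcongr

/-- The coordinate `s mod d`, along which the `s`-th coarsening takes place. -/
def cyclicDir (d : ℕ) (hd : 2 ≤ d) (s : ℕ) : Fin d := ⟨s % d, Nat.mod_lt _ (by omega)⟩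

theorem cyclicDir_succ_ne (d : ℕ) (hd : 2 ≤ d) (s : ℕ) :
    cyclicDir d hd (s + 1) ≠ cyclicDir d hd s := by
  intro h
  have h' : (s + 1) % d = s % d := congrArg Fin.val h
  have h2 : (s + 1) ≡ s + 0 [MOD d] := h'
  have h3 := Nat.ModEq.add_left_cancel' s h2
  have h4 : (1 : ℕ) % d = 0 % d := h3
  rw [Nat.mod_eq_of_lt (by omega : 1 < d), Nat.zero_mod] at h4
  omega

/-- Before stage `s`, coordinate `k` has been halved `(s + (d - 1 - k)) / d` times. -/
theorem coarsen_cyclicDir {d : ℕ} (hd : 2 ≤ d) (J s : ℕ) (hs : s ≤ d * J) (k : Fin d) :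
    coarsen (cyclicDir d hd) s (fun _ => 2 ^ J) k = 2 ^ (J - (s + (d - 1 - k)) / d) := by
  induction s with
  | zero =>
    have : (0 + (d - 1 - (k : ℕ))) / d = 0 := Nat.div_eq_of_lt (by omega)
    rw [this]
    rfl
  | succ s ih =>
    have ih := ih (by omega)
    simp only [coarsen]
    rw [show s + 1 + (d - 1 - (k : ℕ)) = (s + (d - 1 - k)) + 1 by omega, Nat.succ_div]
    have hdvd : d ∣ s + (d - 1 - (k : ℕ)) + 1 ↔ k = cyclicDir d hd s := by
      have hk := k.2
      rw [Fin.ext_iff, cyclicDir]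
      have e : s + (d - 1 - (k : ℕ)) + 1 + k = s + d := by omega
      rw [← Nat.modEq_zero_iff_dvd]
      constructor
      · intro h
        have h1 := h.add_right (k : ℕ)
        rw [e] at h1
        have h2 : (s + d) % d = (0 + k) % d := h1
        rw [Nat.add_mod_right, zero_add, Nat.mod_eq_of_lt hk] at h2
        exact h2.symm
      · intro h
        have h1 : (s + d) ≡ 0 + k [MOD d] := by
          change (s + d) % d = (0 + k) % d
          rw [Nat.add_mod_right, zero_add, Nat.mod_eq_of_lt hk, h]
        rw [← e] at h1
        exact h1.add_right_cancel' _
    by_cases hk : k = cyclicDir d hd s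
    · rw [if_pos (hdvd.2 hk)]
      rw [halve, ← hk, Function.update_self, ih]
      have hlt : (s + (d - 1 - (k : ℕ))) / d < J := by
        obtain ⟨q, hq⟩ := hdvd.2 hk
        have : d * q < d * (J + 1) := by rw [← hq, mul_add]; omega
        have hq' : q ≤ J := Nat.lt_succ_iff.1 (lt_of_mul_lt_mul_left this (Nat.zero_le _))
        rw [Nat.div_lt_iff_lt_mul (by omega)]
        have := Nat.mul_le_mul_left d hq'
        rw [mul_comm J d]
        omega
      obtain ⟨e, he⟩ : ∃ e, J - (s + (d - 1 - (k : ℕ))) / d = e + 1 :=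
        ⟨J - (s + (d - 1 - (k : ℕ))) / d - 1, by omega⟩
      rw [he, show J - ((s + (d - 1 - (k : ℕ))) / d + 1) = e by omega, pow_succ]
      omega
    · rw [if_neg (fun h => hk (hdvd.1 h)), halve, Function.update_of_ne hk, ih]
      rfl

theorem even_coarsen_cyclicDir {d : ℕ} (hd : 2 ≤ d) (J s : ℕ) (hs : s < d * J) :
    Even (coarsen (cyclicDir d hd) s (fun _ => 2 ^ J) (cyclicDir d hd s)) := by
  rw [coarsen_cyclicDir hd J s hs.le]
  have hlt : (s + (d - 1 - s % d)) / d < J := by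
    have h1 : s % d < d := Nat.mod_lt _ (by omega)
    have h2 := Nat.mod_add_div s d
    have h3 : s + (d - 1 - s % d) = (d - 1) + d * (s / d) := by omega
    rw [h3, Nat.add_mul_div_left _ _ (by omega), Nat.div_eq_of_lt (by omega), zero_add]
    exact Nat.div_lt_of_lt_mul hs
  refine (Nat.even_pow.2 ⟨even_two, ?_⟩)
  simp only [cyclicDir]
  omega

theorem box_coarsen_cyclicDir_last {d : ℕ} (hd : 2 ≤ d) (J : ℕ) :
    box (coarsen (cyclicDir d hd) (d * J) fun _ => 2 ^ J) = {fun _ => 0} := by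
  have h : (coarsen (cyclicDir d hd) (d * J) fun _ => 2 ^ J) = fun _ => 1 := by
    funext k
    rw [coarsen_cyclicDir hd J _ le_rfl, Nat.mul_add_div (by omega),
      Nat.div_eq_of_lt (by omega)]
    simp
  rw [h]
  ext b
  rw [mem_box, Finset.mem_singleton, funext_iff]
  simp

/-! ### From the sample to the grid, and the deterministic oracle inequality -/

theorem graphTV_eq {n : ℕ} (G : SimpleGraph (Fin n)) (θ : Fin n → ℝ) :
    graphTV G θ = ∑ e : OrientedEdge G, |θ e.1.1 - θ e.1.2| := by
  simp only [graphTV, incidence_mulVec]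

theorem graphTV_nonneg {n : ℕ} (G : SimpleGraph (Fin n)) (θ : Fin n → ℝ) : 0 ≤ graphTV G θ :=
  Finset.sum_nonneg fun _ _ => abs_nonneg _

theorem graphTV_sub_le {n : ℕ} (G : SimpleGraph (Fin n)) (θ θ' : Fin n → ℝ) :
    graphTV G (fun i => θ i - θ' i) ≤ graphTV G θ + graphTV G θ' := by
  simp only [graphTV_eq]
  rw [← Finset.sum_add_distrib]
  refine Finset.sum_le_sum fun e _ => ?_
  rw [sub_sub_sub_comm]
  exact abs_sub _ _

theorem sum_oriented_le_graphTV {n : ℕ} (G : SimpleGraph (Fin n)) (θ : Fin n → ℝ)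
    (E : Finset (Fin n × Fin n)) (hE : ∀ q ∈ E, q.1 < q.2 ∧ G.Adj q.1 q.2) :
    ∑ q ∈ E, |θ q.1 - θ q.2| ≤ graphTV G θ := by
  rw [graphTV_eq, ← Finset.sum_attach]
  let g : {q // q ∈ E} ↪ OrientedEdge G :=
    ⟨fun q => ⟨q.1, hE q.1 q.2⟩, fun a b h => by
      have : a.1 = b.1 := congrArg (fun e : OrientedEdge G => e.1) h
      exact Subtype.ext this⟩
  calc _ = ∑ e ∈ E.attach.map g, |θ e.1.1 - θ e.1.2| := by
        rw [Finset.sum_map]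
        rfl
    _ ≤ _ := Finset.sum_le_sum_of_subset_of_nonneg (Finset.subset_univ _)
      fun _ _ _ => abs_nonneg _

theorem sum_pairs_le_two_mul_graphTV {n : ℕ} (G : SimpleGraph (Fin n)) (θ : Fin n → ℝ)
    (E : Finset (Fin n × Fin n)) (hE : ∀ q ∈ E, q.1 ≠ q.2 → G.Adj q.1 q.2) :
    ∑ q ∈ E, |θ q.1 - θ q.2| ≤ 2 * graphTV G θ := by
  classical
  have h1 := sum_oriented_le_graphTV G θ (E.filter fun q => q.1 < q.2) fun q hq =>
    ⟨(Finset.mem_filter.1 hq).2, hE q (Finset.mem_filter.1 hq).1 (Finset.mem_filter.1 hq).2.ne⟩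
  have h2 := sum_oriented_le_graphTV G θ ((E.filter fun q => q.2 < q.1).image Prod.swap) <| by
    intro q hq
    obtain ⟨q', hq', rfl⟩ := Finset.mem_image.1 hq
    rw [Finset.mem_filter] at hq'
    exact ⟨hq'.2, (hE q' hq'.1 hq'.2.ne').symm⟩
  rw [Finset.sum_image fun _ _ _ _ h => Prod.swap_injective h] at h2
  simp only [Prod.fst_swap, Prod.snd_swap] at h2
  have h3 : ∑ q ∈ E, |θ q.1 - θ q.2| = ∑ q ∈ E.filter (fun q => q.1 < q.2), |θ q.1 - θ q.2|
      + ∑ q ∈ E.filter (fun q => q.2 < q.1), |θ q.2 - θ q.1| := by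
    rw [Finset.sum_filter, Finset.sum_filter, ← Finset.sum_add_distrib]
    refine Finset.sum_congr rfl fun q _ => ?_
    rcases lt_trichotomy q.1 q.2 with h | h | h
    · rw [if_pos h, if_neg h.not_gt, add_zero]
    · rw [if_neg h.not_lt, if_neg h.not_gt, h, sub_self, abs_zero, add_zero]
    · rw [if_neg h.not_gt, if_pos h, zero_add, abs_sub_comm]
  linarith

/-- The sample points whose cell lies in the cell `b` of stage `s`. -/
def block {d n : ℕ} (dir : ℕ → Fin d) (cell : Fin n → Fin d → ℕ) (s : ℕ) (b : Fin d → ℕ) :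
    Finset (Fin n) :=
  Finset.univ.filter fun i => coarsen dir s (cell i) = b

theorem mem_block {d n : ℕ} {dir : ℕ → Fin d} {cell : Fin n → Fin d → ℕ} {s : ℕ}
    {b : Fin d → ℕ} {i : Fin n} : i ∈ block dir cell s b ↔ coarsen dir s (cell i) = b := by
  simp [block]

theorem block_succ {d n : ℕ} (dir : ℕ → Fin d) (cell : Fin n → Fin d → ℕ) (s : ℕ)
    (b : Fin d → ℕ) : block dir cell (s + 1) b
      = block dir cell s (lowerChild (dir s) b) ∪ block dir cell s (upperChild (dir s) b) := by
  ext i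
  simp only [Finset.mem_union, mem_block, coarsen, halve_eq_iff]

theorem disjoint_block_children {d n : ℕ} (dir : ℕ → Fin d) (cell : Fin n → Fin d → ℕ) (s : ℕ)
    (k : Fin d) (b : Fin d → ℕ) : Disjoint (block dir cell s (lowerChild k b))
      (block dir cell s (upperChild k b)) := by
  rw [Finset.disjoint_left]
  intro i h1 h2
  rw [mem_block] at h1 h2
  exact lowerChild_ne_upperChild k b (h1.symm.trans h2)

theorem card_block_le {d n : ℕ} (dir : ℕ → Fin d) (cell : Fin n → Fin d → ℕ) {M : ℝ}
    (hM : ∀ b, ((block dir cell 0 b).card : ℝ) ≤ M) (s : ℕ) (b : Fin d → ℕ) :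
    ((block dir cell s b).card : ℝ) ≤ 2 ^ s * M := by
  induction s generalizing b with
  | zero => simpa using hM b
  | succ s ih =>
    rw [block_succ, Finset.card_union_of_disjoint (disjoint_block_children _ _ _ _ _), pow_succ]
    push_cast
    linarith [ih (lowerChild (dir s) b), ih (upperChild (dir s) b)]

/-- The average of `Δ` over the sample points in `I`. -/
noncomputable def finsetAvg {n : ℕ} (Δ : Fin n → ℝ) (I : Finset (Fin n)) : ℝ :=
  (∑ i ∈ I, Δ i) / I.card

theorem abs_sub_finsetAvg_le {n : ℕ} (Δ : Fin n → ℝ) (I : Finset (Fin n)) (t : ℝ) {m : ℝ}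
    (hm : 0 < m) (hI : m ≤ I.card) : |t - finsetAvg Δ I| ≤ (∑ j ∈ I, |t - Δ j|) / m := by
  have hc : (0 : ℝ) < I.card := hm.trans_le hI
  have h1 : t - finsetAvg Δ I = (∑ j ∈ I, (t - Δ j)) / I.card := by
    rw [finsetAvg, Finset.sum_sub_distrib, Finset.sum_const, nsmul_eq_mul]
    field_simp
  rw [h1, abs_div, abs_of_pos hc]
  exact div_le_div₀ (Finset.sum_nonneg fun _ _ => abs_nonneg _)
    (Finset.abs_sum_le_sum_abs _ _) hm hI

theorem abs_finsetAvg_sub_finsetAvg_le {n : ℕ} (Δ : Fin n → ℝ) (I I' : Finset (Fin n)) {m : ℝ}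
    (hm : 0 < m) (hI : m ≤ I.card) (hI' : m ≤ I'.card) :
    |finsetAvg Δ I - finsetAvg Δ I'| ≤ (∑ i ∈ I, ∑ j ∈ I', |Δ i - Δ j|) / m ^ 2 := by
  rw [abs_sub_comm]
  refine (abs_sub_finsetAvg_le Δ I _ hm hI).trans ?_
  rw [pow_two, ← div_div]
  refine div_le_div_of_nonneg_right ?_ hm.le
  rw [Finset.sum_div]
  refine Finset.sum_le_sum fun i _ => ?_
  rw [abs_sub_comm]
  exact abs_sub_finsetAvg_le Δ I' _ hm hI'

theorem finsetAvg_sq_le {n : ℕ} (Δ : Fin n → ℝ) (I : Finset (Fin n)) {m : ℝ}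
    (hm : 0 < m) (hI : m ≤ I.card) : finsetAvg Δ I ^ 2 ≤ (∑ i ∈ I, Δ i ^ 2) / m := by
  have hc : (0 : ℝ) < I.card := hm.trans_le hI
  have h := sq_sum_le_card_mul_sum_sq (s := I) (f := Δ)
  calc finsetAvg Δ I ^ 2 = (∑ i ∈ I, Δ i) ^ 2 / (I.card : ℝ) ^ 2 := by rw [finsetAvg, div_pow]
    _ ≤ (I.card * ∑ i ∈ I, Δ i ^ 2) / (I.card : ℝ) ^ 2 := by gcongr
    _ = (∑ i ∈ I, Δ i ^ 2) / I.card := by field_simp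
    _ ≤ _ := by
      have : 0 ≤ ∑ i ∈ I, Δ i ^ 2 := Finset.sum_nonneg fun _ _ => sq_nonneg _
      gcongr

/-- The average of `Δ` over the sample points in the cell `b`. -/
noncomputable def cellAvg {d n : ℕ} (cell : Fin n → Fin d → ℕ) (Δ : Fin n → ℝ)
    (b : Fin d → ℕ) : ℝ :=
  finsetAvg Δ (Finset.univ.filter fun i => cell i = b)

/-- Any two distinct sample points whose cells are equal or adjacent, possibly diagonally, are
joined in `G`. -/
def JoinsNearbyCells {d n : ℕ} (G : SimpleGraph (Fin n)) (cell : Fin n → Fin d → ℕ) : Prop :=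
  ∀ i j, i ≠ j → (∀ k, cell i k ≤ cell j k + 1 ∧ cell j k ≤ cell i k + 1) → G.Adj i j

theorem sum_abs_sub_cellAvg_le {d n : ℕ} {G : SimpleGraph (Fin n)} {cell : Fin n → Fin d → ℕ}
    (hG : JoinsNearbyCells G cell) (Δ : Fin n → ℝ) {m : ℝ} (hm : 0 < m)
    (hcount : ∀ i, m ≤ (Finset.univ.filter fun j => cell j = cell i).card) :
    ∑ i, |Δ i - cellAvg cell Δ (cell i)| ≤ 2 / m * graphTV G Δ := by
  classical
  have h1 : ∑ i, |Δ i - cellAvg cell Δ (cell i)|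
      ≤ (∑ i, ∑ j ∈ Finset.univ.filter (fun j => cell j = cell i), |Δ i - Δ j|) / m := by
    rw [Finset.sum_div]
    exact Finset.sum_le_sum fun i _ => abs_sub_finsetAvg_le Δ _ _ hm (hcount i)
  have h2 := sum_pairs_le_two_mul_graphTV G Δ
    (Finset.univ.filter fun q : Fin n × Fin n => cell q.2 = cell q.1) <| by
      intro q hq hne
      have hq' := (Finset.mem_filter.1 hq).2
      exact hG _ _ hne fun k => by rw [hq']; omega
  rw [Finset.sum_filter, Fintype.sum_prod_type] at h2
  simp only [← Finset.sum_filter] at h2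
  refine h1.trans ?_
  rw [div_mul_eq_mul_div]
  gcongr

theorem dirTV_cellAvg_le {d n : ℕ} {G : SimpleGraph (Fin n)} {cell : Fin n → Fin d → ℕ}
    (hG : JoinsNearbyCells G cell) (Δ : Fin n → ℝ) {m : ℝ} (hm : 0 < m) (L : Fin d → ℕ)
    (hcount : ∀ b ∈ box L, m ≤ (Finset.univ.filter fun j => cell j = b).card) (k : Fin d) :
    dirTV k L (cellAvg cell Δ) ≤ 2 / m ^ 2 * graphTV G Δ := by
  classical
  have h2 := sum_pairs_le_two_mul_graphTV G Δ
    (Finset.univ.filter fun q : Fin n × Fin n => cell q.2 = succAt k (cell q.1)) <| by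
      intro q hq hne
      have hq' := (Finset.mem_filter.1 hq).2
      refine hG _ _ hne fun j => ?_
      rw [hq', succAt]
      by_cases hj : j = k
      · subst hj
        simp
        omega
      · simp [hj]
  rw [Finset.sum_filter, Fintype.sum_prod_type] at h2
  simp only [← Finset.sum_filter] at h2
  have h1 : dirTV k L (cellAvg cell Δ) ≤ (∑ b ∈ box L, ∑ i ∈ Finset.univ.filter (cell · = b),
      ∑ j ∈ Finset.univ.filter (cell · = succAt k (cell i)), |Δ i - Δ j|) / m ^ 2 := by
    rw [dirTV, Finset.sum_div]
    refine Finset.sum_le_sum fun b hb => ?_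
    split_ifs with h
    · have hs : succAt k b ∈ box L := by
        rw [mem_box] at hb ⊢
        intro j
        by_cases hj : j = k
        · subst hj
          simpa [succAt] using h
        · simpa [succAt, hj] using hb j
      refine (abs_finsetAvg_sub_finsetAvg_le Δ _ _ hm (hcount b hb) (hcount _ hs)).trans_eq ?_
      congr 1
      refine Finset.sum_congr rfl fun i hi => ?_
      rw [(Finset.mem_filter.1 hi).2]
    · positivity
  have h3 : ∑ b ∈ box L, ∑ i ∈ Finset.univ.filter (cell · = b),
      ∑ j ∈ Finset.univ.filter (cell · = succAt k (cell i)), |Δ i - Δ j|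
      ≤ ∑ i, ∑ j ∈ Finset.univ.filter (cell · = succAt k (cell i)), |Δ i - Δ j| := by
    have hdisj : (box L : Set (Fin d → ℕ)).PairwiseDisjoint
        fun b => Finset.univ.filter (cell · = b) := by
      intro b _ b' _ hbb'
      rw [Function.onFun, Finset.disjoint_left]
      intro i hi hi'
      exact hbb' ((Finset.mem_filter.1 hi).2.symm.trans (Finset.mem_filter.1 hi').2)
    rw [← Finset.sum_biUnion hdisj]
    exact Finset.sum_le_sum_of_subset_of_nonneg (Finset.subset_univ _)
      fun _ _ _ => Finset.sum_nonneg fun _ _ => abs_nonneg _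
  refine h1.trans ?_
  rw [div_mul_eq_mul_div]
  gcongr
  exact h3.trans h2

/-- The averages at stage `s` add up, up to the number of merged cells, to the same total. -/
theorem sum_coarseAvg {d : ℕ} (dir : ℕ → Fin d) {N : ℕ} {L : Fin d → ℕ}
    (hL : ∀ s < N, Even (coarsen dir s L (dir s))) (A : (Fin d → ℕ) → ℝ) (s : ℕ) (hs : s ≤ N) :
    2 ^ s * ∑ b ∈ box (coarsen dir s L), coarseAvg dir A s b = ∑ b ∈ box L, A b := by
  induction s with
  | zero => simp [coarsen, coarseAvg]
  | succ s ih =>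
    rw [← ih (by omega), sum_box_eq_sum_children (dir s) _ (hL s (by omega)), pow_succ, mul_assoc,
      Finset.mul_sum _ _ (2 : ℝ)]
    congr 1
    refine Finset.sum_congr rfl fun b _ => ?_
    simp only [coarseAvg, mergeAvg]
    ring

theorem sum_cellAvg_sq_le {d n : ℕ} (cell : Fin n → Fin d → ℕ) (Δ : Fin n → ℝ) {m : ℝ}
    (hm : 0 < m) (L : Fin d → ℕ)
    (hcount : ∀ b ∈ box L, m ≤ (Finset.univ.filter fun j => cell j = b).card)
    (hcell : ∀ i, cell i ∈ box L) :
    ∑ b ∈ box L, cellAvg cell Δ b ^ 2 ≤ (∑ i, Δ i ^ 2) / m := by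
  rw [← Finset.sum_fiberwise_of_maps_to (s := Finset.univ) (t := box L) (g := cell)
    fun i _ => hcell i, Finset.sum_div]
  exact Finset.sum_le_sum fun b hb => finsetAvg_sq_le Δ _ hm (hcount b hb)

theorem card_box_const (d q : ℕ) : (box fun _ : Fin d => q).card = q ^ d := by
  simp [box]

/-- The noise is controlled by the total variation along the graph, up to the contribution of the
overall mean. -/
theorem abs_sum_noise_mul_le {d n : ℕ} (hd : 2 ≤ d) {G : SimpleGraph (Fin n)}
    {cell : Fin n → Fin d → ℕ} (hG : JoinsNearbyCells G cell) (J : ℕ)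
    (hcell : ∀ i, cell i ∈ box fun _ => 2 ^ J) {m M : ℝ} (hm : 0 < m) (hM : 0 ≤ M)
    (hlow : ∀ b ∈ box (fun _ : Fin d => 2 ^ J), m ≤ (Finset.univ.filter (cell · = b)).card)
    (hupp : ∀ b ∈ box (fun _ : Fin d => 2 ^ J), ((Finset.univ.filter (cell · = b)).card : ℝ) ≤ M)
    (e Δ : Fin n → ℝ) {a : ℝ} (ha : 0 ≤ a) (he : ∀ i, |e i| ≤ a)
    (hblock : ∀ s ≤ d * J, ∀ b, |∑ i ∈ block (cyclicDir d hd) cell s b, e i|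
      ≤ a * √(block (cyclicDir d hd) cell s b).card) :
    |∑ i, e i * Δ i| ≤ (2 * a / m + (d * J) * (2 * a * √M / m ^ 2)) * graphTV G Δ
      + √(a ^ 2 * n / (2 ^ (d * J) * m)) * √(∑ i, Δ i ^ 2) := by
  set dir := cyclicDir d hd with hdir
  set L : Fin d → ℕ := fun _ => 2 ^ J with hL
  set A := cellAvg cell Δ with hA
  set S : ℕ → (Fin d → ℕ) → ℝ := fun s b => ∑ i ∈ block dir cell s b, e i with hS
  have hblock0 : ∀ b, block dir cell 0 b = Finset.univ.filter (cell · = b) := fun b => rfl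
  have hM' : ∀ b, ((block dir cell 0 b).card : ℝ) ≤ M := by
    intro b
    by_cases hb : b ∈ box L
    · exact hupp b hb
    · have : block dir cell 0 b = ∅ := by
        rw [hblock0, Finset.filter_eq_empty_iff]
        intro i _ hi
        exact hb (hi ▸ hcell i)
      simpa [this] using hM
  have hsplit : ∑ i, e i * Δ i = ∑ i, e i * (Δ i - A (cell i)) + ∑ b ∈ box L, S 0 b * A b := by
    have : ∑ b ∈ box L, S 0 b * A b = ∑ i, e i * A (cell i) := by
      rw [← Finset.sum_fiberwise_of_maps_to (s := Finset.univ) (t := box L) (g := cell)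
        fun i _ => hcell i]
      refine Finset.sum_congr rfl fun b _ => ?_
      rw [hS]
      simp only [hblock0]
      rw [Finset.sum_mul]
      refine Finset.sum_congr rfl fun i hi => ?_
      rw [(Finset.mem_filter.1 hi).2]
    rw [this, ← Finset.sum_add_distrib]
    exact Finset.sum_congr rfl fun i _ => by ring
  have hfirst : |∑ i, e i * (Δ i - A (cell i))| ≤ 2 * a / m * graphTV G Δ := by
    calc _ ≤ ∑ i, |e i * (Δ i - A (cell i))| := Finset.abs_sum_le_sum_abs _ _
      _ ≤ ∑ i, a * |Δ i - A (cell i)| := Finset.sum_le_sum fun i _ => by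
          rw [abs_mul]
          gcongr
          exact he i
      _ ≤ a * (2 / m * graphTV G Δ) := by
          rw [← Finset.mul_sum]
          gcongr
          exact sum_abs_sub_cellAvg_le hG Δ hm fun i => hlow _ (hcell i)
      _ = _ := by ring
  have heven : ∀ s < d * J, Even (coarsen dir s L (dir s)) := fun s hs =>
    even_coarsen_cyclicDir hd J s hs
  have hmain := abs_sum_box_mul_le (cyclicDir_succ_ne d hd) (d * J) heven A S
    (fun s b => by
      simp only [hS]
      rw [block_succ, Finset.sum_union (disjoint_block_children _ _ _ _ _)])
    (τ := a * √M) (fun s hs b => by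
      refine (hblock s hs.le b).trans ?_
      rw [mul_assoc]
      gcongr
      have h2 : √2 ^ s = √(2 ^ s) := by rw [Real.sqrt_eq_rpow, Real.sqrt_eq_rpow,
        ← Real.rpow_natCast, ← Real.rpow_natCast, ← Real.rpow_mul (by norm_num),
        ← Real.rpow_mul (by norm_num), mul_comm]
      rw [h2, ← Real.sqrt_mul hM, mul_comm M]
      exact Real.sqrt_le_sqrt (card_block_le dir cell hM' s b))
  have hTV : a * √M * ∑ s ∈ Finset.range (d * J), dirTV (dir s) L A
      ≤ (d * J) * (2 * a * √M / m ^ 2) * graphTV G Δ := by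
    calc _ ≤ a * √M * ∑ s ∈ Finset.range (d * J), 2 / m ^ 2 * graphTV G Δ := by
          gcongr
          exact dirTV_cellAvg_le hG Δ hm L hlow _
      _ = _ := by
          rw [Finset.sum_const, Finset.card_range, nsmul_eq_mul]
          push_cast
          ring
  have hlast : |∑ b ∈ box (coarsen dir (d * J) L), S (d * J) b * coarseAvg dir A (d * J) b|
      ≤ √(a ^ 2 * n / (2 ^ (d * J) * m)) * √(∑ i, Δ i ^ 2) := by
    have hmean := sum_coarseAvg dir heven A (d * J) le_rfl
    rw [box_coarsen_cyclicDir_last hd J, Finset.sum_singleton] at hmean ⊢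
    have hS2 : S (d * J) (fun _ => 0) ^ 2 ≤ a ^ 2 * n := by
      rw [← sq_abs]
      calc _ ≤ (a * √(block dir cell (d * J) fun _ => 0).card) ^ 2 :=
            pow_le_pow_left₀ (abs_nonneg _) (hblock _ le_rfl _) 2
        _ = a ^ 2 * (block dir cell (d * J) fun _ => 0).card := by
            rw [mul_pow, Real.sq_sqrt (Nat.cast_nonneg _)]
        _ ≤ a ^ 2 * n := by
            gcongr
            exact (Finset.card_le_univ _).trans_eq (Fintype.card_fin n)
    have hA2 : coarseAvg dir A (d * J) (fun _ => 0) ^ 2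
        ≤ (∑ i, Δ i ^ 2) / (2 ^ (d * J) * m) := by
      have h1 := sq_sum_le_card_mul_sum_sq (s := box L) (f := A)
      have h2 := sum_cellAvg_sq_le cell Δ hm L hlow hcell
      rw [← hmean, hL, card_box_const, ← pow_mul, mul_comm J d] at h1
      push_cast at h1
      have hpos : (0 : ℝ) < 2 ^ (d * J) := by positivity
      have h3 : (2 ^ (d * J) : ℝ) * (2 ^ (d * J) * coarseAvg dir A (d * J) (fun _ => 0) ^ 2)
          ≤ 2 ^ (d * J) * ((∑ i, Δ i ^ 2) / m) := by
        calc _ = (2 ^ (d * J) * coarseAvg dir A (d * J) fun _ => 0) ^ 2 := by ring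
          _ ≤ _ := h1.trans (by gcongr)
      have h4 := le_of_mul_le_mul_left h3 hpos
      rw [mul_comm (2 ^ (d * J) : ℝ) m, ← div_div, le_div_iff₀ hpos]
      linarith
    rw [← Real.sqrt_sq_eq_abs, ← Real.sqrt_mul (by positivity)]
    refine Real.sqrt_le_sqrt ?_
    rw [mul_pow]
    calc _ ≤ (a ^ 2 * n) * ((∑ i, Δ i ^ 2) / (2 ^ (d * J) * m)) := by gcongr
      _ = _ := by ring
  rw [hsplit]
  refine (abs_add_le _ _).trans ?_
  rw [add_mul]
  linarith

/-- The oracle inequality for a penalty that dominates the noise, up to a term `B ‖θ̂ - θ‖₂`. -/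
theorem sum_sq_sub_le_of_isFusedLasso {n : ℕ} {G : SimpleGraph (Fin n)} {θ e θhat : Fin n → ℝ}
    {lam B : ℝ} (hlam : 0 ≤ lam) (h : IsFusedLasso (fun i => θ i + e i) G lam θhat)
    (hnoise : ∑ i, e i * (θhat i - θ i) ≤ lam * graphTV G (fun i => θhat i - θ i)
      + B * √(∑ i, (θhat i - θ i) ^ 2)) :
    ∑ i, (θhat i - θ i) ^ 2 ≤ 4 * B ^ 2 + 8 * lam * graphTV G θ := by
  have h0 := h θ
  unfold objective at h0
  have h1 : ∑ i, (θ i + e i - θhat i) ^ 2 = ∑ i, (θ i + e i - θ i) ^ 2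
      - 2 * ∑ i, e i * (θhat i - θ i) + ∑ i, (θhat i - θ i) ^ 2 := by
    rw [Finset.mul_sum, ← Finset.sum_sub_distrib, ← Finset.sum_add_distrib]
    exact Finset.sum_congr rfl fun i _ => by ring
  rw [h1] at h0
  have h2 := mul_le_mul_of_nonneg_left (graphTV_sub_le G θhat θ) hlam
  have h3 : 0 ≤ ∑ i, (θhat i - θ i) ^ 2 := Finset.sum_nonneg fun _ _ => sq_nonneg _
  have h4 := Real.sq_sqrt h3
  nlinarith [sq_nonneg (√(∑ i, (θhat i - θ i) ^ 2) / 2 - B)]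

/-! ### Concentration of the errors and of the cell counts -/

theorem exp_le_add_exp_sq (u : ℝ) : Real.exp u ≤ u + Real.exp (u ^ 2) := by
  have h1 := Real.add_one_le_exp (u ^ 2)
  rcases le_or_gt |u| 1 with h | h
  · have := (abs_le.1 (Real.abs_exp_sub_one_sub_id_le h)).2
    linarith
  · rcases lt_abs.1 h with h | h
    · have : Real.exp u ≤ Real.exp (u ^ 2) := Real.exp_le_exp.2 (by nlinarith)
      linarith
    · have : Real.exp u ≤ 1 := Real.exp_le_one_iff.2 (by linarith)
      nlinarith

/-- A sub-Gaussian tail bounds the exponential moment of the square. -/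
theorem lintegral_exp_sq_le {Ω : Type*} [MeasurableSpace Ω] {P : Measure Ω}
    [IsProbabilityMeasure P] {X : Ω → ℝ} (hX : Measurable X) {C σ : ℝ} (hC : 0 ≤ C) (hσ : 0 < σ)
    (htail : ∀ t : ℝ, 0 < t →
      P {ω | t < |X ω|} ≤ ENNReal.ofReal (C * Real.exp (-t ^ 2 / (2 * σ ^ 2)))) :
    ∫⁻ ω, ENNReal.ofReal (Real.exp (X ω ^ 2 / (4 * σ ^ 2))) ∂P ≤ ENNReal.ofReal (1 + C) := by
  rw [lintegral_eq_lintegral_meas_lt P (Eventually.of_forall fun _ => (Real.exp_pos _).le)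
    (by fun_prop)]
  rw [← Set.Ioc_union_Ioi_eq_Ioi (zero_le_one' ℝ)]
  refine (lintegral_union_le _ _ _).trans ?_
  rw [ENNReal.ofReal_add zero_le_one hC]
  refine add_le_add ?_ ?_
  · calc _ ≤ ∫⁻ _ in Set.Ioc (0 : ℝ) 1, 1 := lintegral_mono fun _ => prob_le_one
      _ = _ := by simp
  · have h1 : ∀ t ∈ Set.Ioi (1 : ℝ), P {ω | t < Real.exp (X ω ^ 2 / (4 * σ ^ 2))}
        ≤ ENNReal.ofReal (C * t ^ (-2 : ℝ)) := by
      intro t ht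
      have ht1 : (1 : ℝ) < t := ht
      have hlog : 0 < Real.log t := Real.log_pos ht1
      have hs : 0 < 2 * σ * √(Real.log t) := by positivity
      have hsq : (2 * σ * √(Real.log t)) ^ 2 = 4 * σ ^ 2 * Real.log t := by
        rw [mul_pow, Real.sq_sqrt hlog.le]
        ring
      calc _ ≤ P {ω | 2 * σ * √(Real.log t) < |X ω|} := by
            refine measure_mono fun ω hω => ?_
            have hω' : t < Real.exp (X ω ^ 2 / (4 * σ ^ 2)) := hω
            have h2 : Real.log t < X ω ^ 2 / (4 * σ ^ 2) :=
              (Real.log_lt_iff_lt_exp (by linarith)).2 hω'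
            rw [lt_div_iff₀ (by positivity)] at h2
            change 2 * σ * √(Real.log t) < |X ω|
            refine lt_of_pow_lt_pow_left₀ 2 (abs_nonneg _) ?_
            rw [hsq, sq_abs]
            linarith
        _ ≤ _ := htail _ hs
        _ = _ := by
            rw [hsq, Real.rpow_def_of_pos (by linarith)]
            congr 3
            field_simp
            ring
    calc _ ≤ ∫⁻ t in Set.Ioi (1 : ℝ), ENNReal.ofReal (C * t ^ (-2 : ℝ)) :=
          setLIntegral_mono' measurableSet_Ioi h1
      _ = ENNReal.ofReal (∫ t in Set.Ioi (1 : ℝ), C * t ^ (-2 : ℝ)) := by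
          rw [ofReal_integral_eq_lintegral_ofReal]
          · exact ((integrableOn_Ioi_rpow_of_lt (by norm_num) one_pos).const_mul C)
          · filter_upwards [ae_restrict_mem measurableSet_Ioi] with t ht
            have : (0 : ℝ) < t := lt_trans one_pos ht
            positivity
      _ ≤ _ := by
          rw [integral_const_mul, integral_Ioi_rpow_of_lt (by norm_num) one_pos]
          norm_num

/-- A centred random variable with a sub-Gaussian tail has a sub-Gaussian moment generating
function. For small arguments this follows from `exp u ≤ u + exp (u ^ 2)`, for large ones from
`2 u v ≤ u ^ 2 + v ^ 2`. -/
theorem hasSubgaussianMGF_of_tail {Ω : Type*} [MeasurableSpace Ω] {P : Measure Ω}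
    [IsProbabilityMeasure P] {X : Ω → ℝ} (hX : Measurable X) (hint : Integrable X P)
    (hmean : ∫ ω, X ω ∂P = 0) {C σ : ℝ} (hC : 0 ≤ C) (hσ : 0 < σ)
    (htail : ∀ t : ℝ, 0 < t →
      P {ω | t < |X ω|} ≤ ENNReal.ofReal (C * Real.exp (-t ^ 2 / (2 * σ ^ 2)))) :
    HasSubgaussianMGF X (4 * σ ^ 2 * (1 + 2 * C)).toNNReal P := by
  set Y : Ω → ℝ := fun ω => Real.exp (X ω ^ 2 / (4 * σ ^ 2)) with hY
  have hl := lintegral_exp_sq_le hX hC hσ htail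
  have hYm : Measurable Y := by fun_prop
  have hYi : Integrable Y P := by
    refine ⟨hYm.aestronglyMeasurable, ?_⟩
    rw [hasFiniteIntegral_iff_ofReal (Eventually.of_forall fun _ => (Real.exp_pos _).le)]
    exact hl.trans_lt ENNReal.ofReal_lt_top
  have hYE : ∫ ω, Y ω ∂P ≤ 1 + C := by
    rw [integral_eq_lintegral_of_nonneg_ae (Eventually.of_forall fun _ => (Real.exp_pos _).le)
      hYm.aestronglyMeasurable]
    exact ENNReal.toReal_le_of_le_ofReal (by linarith) hl
  have hlarge : ∀ s ω, Real.exp (s * X ω) ≤ Real.exp (4 * σ ^ 2 * s ^ 2 / 2) * Y ω := by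
    intro s ω
    rw [hY, ← Real.exp_add, Real.exp_le_exp]
    have h1 : s * X ω = (2 * σ * s) * (X ω / (2 * σ)) := by field_simp
    have h2 : X ω ^ 2 / (4 * σ ^ 2) = (X ω / (2 * σ)) ^ 2 := by rw [div_pow]; ring
    rw [h1, h2]
    nlinarith [sq_nonneg (2 * σ * s - X ω / (2 * σ)), sq_nonneg (X ω / (2 * σ))]
  have hexp : ∀ s, Integrable (fun ω => Real.exp (s * X ω)) P := by
    intro s
    refine (hYi.const_mul (Real.exp (4 * σ ^ 2 * s ^ 2 / 2))).mono'
      (by fun_prop) (Eventually.of_forall fun ω => ?_)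
    rw [Real.norm_eq_abs, abs_of_pos (Real.exp_pos _)]
    exact hlarge s ω
  refine ⟨hexp, fun s => ?_⟩
  rw [Real.coe_toNNReal _ (by positivity)]
  set a := 4 * σ ^ 2 * s ^ 2 with ha
  have ha0 : 0 ≤ a := by positivity
  have hgoal : 4 * σ ^ 2 * (1 + 2 * C) * s ^ 2 / 2 = a / 2 + a * C := by rw [ha]; ring
  rw [hgoal, mgf]
  rcases le_or_gt a 1 with ha1 | ha1
  · have hpt : ∀ ω, Real.exp (s * X ω) ≤ s * X ω + (1 + a * (Y ω - 1)) := by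
      intro ω
      refine (exp_le_add_exp_sq _).trans ?_
      gcongr
      have h1 : (s * X ω) ^ 2 = (1 - a) • (0 : ℝ) + a • (X ω ^ 2 / (4 * σ ^ 2)) := by
        rw [ha, smul_zero, zero_add, smul_eq_mul]
        field_simp
      have h2 := convexOn_exp.2 (Set.mem_univ (0 : ℝ)) (Set.mem_univ (X ω ^ 2 / (4 * σ ^ 2)))
        (sub_nonneg.2 ha1) ha0 (by ring)
      rw [← h1] at h2
      simp only [smul_eq_mul, Real.exp_zero] at h2
      linarith
    have hY1 : Integrable (fun ω => a * (Y ω - 1)) P :=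
      (hYi.sub (integrable_const _)).const_mul a
    have hi : Integrable (fun ω => 1 + a * (Y ω - 1)) P := (integrable_const _).add hY1
    calc _ ≤ ∫ ω, s * X ω + (1 + a * (Y ω - 1)) ∂P :=
          integral_mono (hexp s) ((hint.const_mul s).add hi) hpt
      _ = 1 + a * (∫ ω, Y ω ∂P - 1) := by
          rw [integral_add (hint.const_mul s) hi, integral_const_mul, hmean,
            integral_add (integrable_const _) hY1, integral_const_mul,
            integral_sub hYi (integrable_const _)]
          simp
      _ ≤ 1 + a * C := by gcongr; linarith
      _ ≤ Real.exp (a * C) := by linarith [Real.add_one_le_exp (a * C)]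
      _ ≤ _ := Real.exp_le_exp.2 (by linarith)
  · calc _ ≤ ∫ ω, Real.exp (a / 2) * Y ω ∂P :=
          integral_mono (hexp s) (hYi.const_mul _) fun ω => hlarge s ω
      _ = Real.exp (a / 2) * ∫ ω, Y ω ∂P := integral_const_mul _ _
      _ ≤ Real.exp (a / 2) * Real.exp (a * C) := by
          gcongr
          refine hYE.trans ?_
          have := Real.add_one_le_exp (a * C)
          nlinarith
      _ = _ := (Real.exp_add _ _).symm

/-- Hoeffding's inequality for the sum of the errors over a fixed set of indices. The strict
inequality makes the event empty for the empty set. -/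
theorem measure_sqrt_card_lt_abs_sum_le {Ω : Type*} [MeasurableSpace Ω] {P : Measure Ω}
    [IsProbabilityMeasure P] {n : ℕ} {ξ : Fin n → Ω → ℝ} (hindep : iIndepFun ξ P) {v : NNReal}
    (hv : 0 < v) (hsub : ∀ i, HasSubgaussianMGF (ξ i) v P) {a : ℝ} (ha : 0 ≤ a)
    (I : Finset (Fin n)) :
    P {ω | a * √I.card < |∑ i ∈ I, ξ i ω|} ≤ ENNReal.ofReal (2 * Real.exp (-a ^ 2 / (2 * v))) := by
  rcases I.eq_empty_or_nonempty with rfl | hI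
  · simp
  have hc : (0 : ℝ) < I.card := by exact_mod_cast hI.card_pos
  have hv' : (0 : ℝ) < v := hv
  have key : ∀ ζ : Fin n → Ω → ℝ, iIndepFun ζ P → (∀ i, HasSubgaussianMGF (ζ i) v P) →
      P {ω | a * √I.card ≤ ∑ i ∈ I, ζ i ω} ≤ ENNReal.ofReal (Real.exp (-a ^ 2 / (2 * v))) := by
    intro ζ h1 h2
    have h3 := HasSubgaussianMGF.measure_sum_ge_le_of_iIndepFun h1 (c := fun _ => v) (s := I)
      (fun i _ => h2 i) (ε := a * √I.card) (by positivity)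
    rw [← ENNReal.ofReal_toReal (measure_ne_top P _)]
    refine ENNReal.ofReal_le_ofReal (h3.trans_eq ?_)
    rw [mul_pow, Real.sq_sqrt hc.le, Finset.sum_const, nsmul_eq_mul]
    push_cast
    congr 1
    field_simp
  have h1 := key ξ hindep hsub
  have h2 := key (fun i ω => -ξ i ω)
    (hindep.comp (fun _ => fun t : ℝ => -t) fun _ => measurable_neg) fun i => (hsub i).neg
  rw [two_mul, ENNReal.ofReal_add (Real.exp_pos _).le (Real.exp_pos _).le]
  refine le_trans (measure_mono fun ω hω => ?_) ((measure_union_le _ _).trans (add_le_add h1 h2))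
  have hω' : a * √I.card < |∑ i ∈ I, ξ i ω| := hω
  rcases lt_abs.1 hω' with h | h
  · exact Or.inl h.le
  · refine Or.inr ?_
    change a * √I.card ≤ ∑ i ∈ I, -ξ i ω
    rw [Finset.sum_neg_distrib]
    exact h.le

/-- Hoeffding's inequality for the sum of the errors over a random set of indices that depends
on the covariates only: condition on the set, which takes finitely many values. -/
theorem measure_sqrt_card_lt_abs_sum_random_le {Ω X : Type*} [MeasurableSpace Ω]
    [MeasurableSpace X] {P : Measure Ω} [IsProbabilityMeasure P] {n : ℕ} {ξ : Fin n → Ω → ℝ}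
    {x : Fin n → Ω → X} (hx : ∀ i, Measurable (x i))
    (hindep : iIndepFun ξ P) (hξx : IndepFun (fun ω i => ξ i ω) (fun ω i => x i ω) P) {v : NNReal}
    (hv : 0 < v) (hsub : ∀ i, HasSubgaussianMGF (ξ i) v P) {a : ℝ} (ha : 0 ≤ a)
    (I : (Fin n → X) → Finset (Fin n)) (hI : ∀ s, MeasurableSet {z | I z = s}) :
    P {ω | a * √(I fun i => x i ω).card < |∑ i ∈ I fun i => x i ω, ξ i ω|}
      ≤ ENNReal.ofReal (2 * Real.exp (-a ^ 2 / (2 * v))) := by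
  set B := ENNReal.ofReal (2 * Real.exp (-a ^ 2 / (2 * v))) with hB
  set E : Finset (Fin n) → Set (Fin n → ℝ) := fun s => {e | a * √s.card < |∑ i ∈ s, e i|} with hE
  set F : Finset (Fin n) → Set Ω := fun s => (fun ω i => x i ω) ⁻¹' {z | I z = s} with hF
  have hxm : Measurable fun ω i => x i ω := measurable_pi_lambda _ hx
  have hEm : ∀ s, MeasurableSet (E s) := fun s => measurableSet_lt measurable_const (by fun_prop)
  have hFm : ∀ s, MeasurableSet (F s) := fun s => hxm (hI s)
  have hsum : ∑ s, P (F s) ≤ 1 := by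
    rw [← measure_biUnion_finset _ fun s _ => hFm s]
    · exact prob_le_one
    · intro s _ s' _ hss'
      rw [Function.onFun, Set.disjoint_left]
      intro ω h1 h2
      have h1' : I (fun i => x i ω) = s := h1
      exact hss' (h1'.symm.trans h2)
  calc _ ≤ P (⋃ s, ((fun ω i => ξ i ω) ⁻¹' E s ∩ F s)) := by
        refine measure_mono fun ω hω => Set.mem_iUnion.2 ⟨I fun i => x i ω, hω, rfl⟩
    _ ≤ ∑ s, P ((fun ω i => ξ i ω) ⁻¹' E s ∩ F s) := measure_iUnion_fintype_le _ _
    _ ≤ ∑ s, B * P (F s) := by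
        refine Finset.sum_le_sum fun s _ => ?_
        rw [hξx.measure_inter_preimage_eq_mul _ _ (hEm s) (hI s)]
        gcongr
        exact measure_sqrt_card_lt_abs_sum_le hindep hv hsub ha s
    _ = B * ∑ s, P (F s) := by rw [Finset.mul_sum]
    _ ≤ B * 1 := by gcongr
    _ = B := mul_one B

/-- The exponential moments of the number of covariates in a set of probability `q`. -/
theorem integral_exp_card_filter_le {Ω X : Type*} [MeasurableSpace Ω] [MeasurableSpace X]
    {P : Measure Ω} [IsProbabilityMeasure P] {n : ℕ} {x : Fin n → Ω → X}
    (hx : ∀ i, Measurable (x i)) (hindep : iIndepFun x P) {Q : Set X} [DecidablePred (· ∈ Q)]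
    (hQ : MeasurableSet Q) {q : ℝ} (hq : ∀ i, P.real (x i ⁻¹' Q) = q) (t : ℝ) :
    Integrable (fun ω => Real.exp (t * (Finset.univ.filter fun i => x i ω ∈ Q).card)) P ∧
      mgf (fun ω => ((Finset.univ.filter fun i => x i ω ∈ Q).card : ℝ)) P t
        ≤ Real.exp (n * (q * (Real.exp t - 1))) := by
  set g : X → ℝ := fun z => if z ∈ Q then 1 else 0 with hg
  have hgm : Measurable g := Measurable.ite hQ measurable_const measurable_const
  set Z : Fin n → Ω → ℝ := fun i ω => g (x i ω) with hZ
  have hZm : ∀ i, Measurable (Z i) := fun i => hgm.comp (hx i)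
  have hZi : iIndepFun Z P := hindep.comp (fun _ => g) fun _ => hgm
  have hcard : (fun ω => ((Finset.univ.filter fun i => x i ω ∈ Q).card : ℝ)) = ∑ i, Z i := by
    funext ω
    simp [hZ, hg, Finset.sum_apply]
  have hexpZ : ∀ i ω, Real.exp (t * Z i ω)
      = 1 + (x i ⁻¹' Q).indicator (fun _ => Real.exp t - 1) ω := by
    intro i ω
    by_cases h : x i ω ∈ Q <;> simp [hZ, hg, h, Set.indicator]
  have hmgf : ∀ i, mgf (Z i) P t = 1 + q * (Real.exp t - 1) := by
    intro i
    rw [mgf]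
    simp only [hexpZ]
    rw [integral_add (integrable_const _)
      ((integrable_const _).indicator (hx i hQ)), integral_indicator_const _ (hx i hQ), hq i]
    simp
  refine ⟨?_, ?_⟩
  · have hm : Measurable fun ω => ((Finset.univ.filter fun i => x i ω ∈ Q).card : ℝ) := by
      rw [hcard, Finset.sum_fn]
      exact Finset.univ.measurable_sum fun i _ => hZm i
    refine Integrable.of_bound (C := Real.exp (|t| * n)) (hm.const_mul t).exp.aestronglyMeasurable
      (Eventually.of_forall fun ω => ?_)
    rw [Real.norm_eq_abs, abs_of_pos (Real.exp_pos _), Real.exp_le_exp]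
    have h1 : ((Finset.univ.filter fun i => x i ω ∈ Q).card : ℝ) ≤ n := by
      exact_mod_cast (Finset.card_le_univ _).trans_eq (Fintype.card_fin n)
    calc _ ≤ |t| * ((Finset.univ.filter fun i => x i ω ∈ Q).card : ℝ) := by
          gcongr
          exact le_abs_self t
      _ ≤ _ := by gcongr
  · rw [hcard, hZi.mgf_sum hZm, Finset.prod_congr rfl fun i _ => hmgf i, Finset.prod_const,
      Finset.card_univ, Fintype.card_fin, Real.exp_nat_mul]
    rcases Nat.eq_zero_or_pos n with rfl | hn
    · simp
    · have h0 : 0 ≤ 1 + q * (Real.exp t - 1) := by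
        rw [← hmgf ⟨0, hn⟩]
        exact mgf_nonneg
      refine pow_le_pow_left₀ h0 ?_ n
      linarith [Real.add_one_le_exp (q * (Real.exp t - 1))]

/-- Chernoff's bounds for the number of covariates in a set. -/
theorem measure_card_filter_le {Ω X : Type*} [MeasurableSpace Ω] [MeasurableSpace X]
    {P : Measure Ω} [IsProbabilityMeasure P] {n : ℕ} {x : Fin n → Ω → X}
    (hx : ∀ i, Measurable (x i)) (hindep : iIndepFun x P) {Q : Set X} [DecidablePred (· ∈ Q)]
    (hQ : MeasurableSet Q) {q u w : ℝ} (hq : ∀ i, P.real (x i ⁻¹' Q) = q) (huq : u ≤ q)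
    (hqw : q ≤ w) (hu : 0 ≤ u) :
    P {ω | ((Finset.univ.filter fun i => x i ω ∈ Q).card : ℝ) < n * u / 4 ∨
        3 * (n * w) < ((Finset.univ.filter fun i => x i ω ∈ Q).card : ℝ)}
      ≤ ENNReal.ofReal (Real.exp (-(n * u / 4)) + Real.exp (-(n * w))) := by
  have hn : (0 : ℝ) ≤ n := Nat.cast_nonneg n
  have hlow : P {ω | ((Finset.univ.filter fun i => x i ω ∈ Q).card : ℝ) ≤ n * u / 4}
      ≤ ENNReal.ofReal (Real.exp (-(n * u / 4))) := by
    obtain ⟨hi, hm⟩ := integral_exp_card_filter_le hx hindep hQ hq (-1)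
    have h := measure_le_le_exp_mul_mgf (n * u / 4) (by norm_num : (-1 : ℝ) ≤ 0) hi
    rw [← ENNReal.ofReal_toReal (measure_ne_top P _)]
    refine ENNReal.ofReal_le_ofReal (h.trans ?_)
    refine (mul_le_mul_of_nonneg_left hm (Real.exp_pos _).le).trans ?_
    rw [← Real.exp_add, Real.exp_le_exp]
    have he : Real.exp (-1) ≤ 1 / 2 := by
      rw [Real.exp_neg, inv_eq_one_div]
      have := Real.add_one_le_exp (1 : ℝ)
      exact one_div_le_one_div_of_le two_pos (by linarith)
    have h1 : (n : ℝ) * (q * (Real.exp (-1) - 1)) ≤ n * (u * (-(1 / 2))) := by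
      refine mul_le_mul_of_nonneg_left ?_ hn
      nlinarith
    linarith
  have hupp : P {ω | 3 * (n * w) ≤ ((Finset.univ.filter fun i => x i ω ∈ Q).card : ℝ)}
      ≤ ENNReal.ofReal (Real.exp (-(n * w))) := by
    obtain ⟨hi, hm⟩ := integral_exp_card_filter_le hx hindep hQ hq 1
    have h := measure_ge_le_exp_mul_mgf (3 * (n * w)) (zero_le_one' ℝ) hi
    rw [← ENNReal.ofReal_toReal (measure_ne_top P _)]
    refine ENNReal.ofReal_le_ofReal (h.trans ?_)
    refine (mul_le_mul_of_nonneg_left hm (Real.exp_pos _).le).trans ?_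
    rw [← Real.exp_add, Real.exp_le_exp]
    have he := Real.exp_one_lt_d9
    have h1 : (n : ℝ) * (q * (Real.exp 1 - 1)) ≤ n * (w * 2) := by
      refine mul_le_mul_of_nonneg_left ?_ hn
      nlinarith
    linarith
  rw [ENNReal.ofReal_add (Real.exp_pos _).le (Real.exp_pos _).le]
  refine le_trans (measure_mono fun ω hω => ?_)
    ((measure_union_le _ _).trans (add_le_add hlow hupp))
  rcases hω with h | h
  · exact Or.inl h.le
  · exact Or.inr h.le

/-! ### The dyadic cells of the covariate space -/

theorem norm_sub_le_of_forall_abs_le {d : ℕ} {z z' : EuclideanSpace ℝ (Fin d)} {ρ : ℝ}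
    (hρ : 0 ≤ ρ) (h : ∀ k, |z k - z' k| ≤ ρ) : ‖z - z'‖ ≤ d * ρ := by
  rw [EuclideanSpace.norm_eq]
  refine Real.sqrt_le_iff.2 ⟨by positivity, ?_⟩
  calc ∑ k, ‖(z - z') k‖ ^ 2 ≤ ∑ _k : Fin d, ρ ^ 2 := Finset.sum_le_sum fun k _ => by
        rw [Real.norm_eq_abs]
        exact pow_le_pow_left₀ (abs_nonneg _) (h k) 2
    _ = d * ρ ^ 2 := by simp
    _ ≤ (d * d) * ρ ^ 2 := by
        gcongr
        exact_mod_cast Nat.le_mul_self d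
    _ = (d * ρ) ^ 2 := by ring

theorem abs_sub_apply_le_norm {d : ℕ} (z z' : EuclideanSpace ℝ (Fin d)) (k : Fin d) :
    |z k - z' k| ≤ ‖z - z'‖ := by
  have := PiLp.norm_apply_le (z - z') k
  rwa [Real.norm_eq_abs] at this

/-- The index of the dyadic cell of side `2⁻ᴶ` that contains `z`. The cells are half-open, except
that those at the upper boundary of the cube also contain their upper faces. -/
noncomputable def cellIndex {d : ℕ} (J : ℕ) (z : EuclideanSpace ℝ (Fin d)) (k : Fin d) : ℕ :=
  min ⌊2 ^ J * z k⌋₊ (2 ^ J - 1)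

theorem cellIndex_mem_box {d : ℕ} (J : ℕ) (z : EuclideanSpace ℝ (Fin d)) :
    cellIndex J z ∈ box fun _ => 2 ^ J := by
  rw [mem_box]
  intro k
  have : 0 < 2 ^ J := by positivity
  exact (min_le_right _ _).trans_lt (by omega)

theorem measurable_cellIndex {d : ℕ} (J : ℕ) :
    Measurable (cellIndex J : EuclideanSpace ℝ (Fin d) → Fin d → ℕ) := by
  refine measurable_pi_lambda _ fun k => ?_
  have h1 : Measurable fun z : EuclideanSpace ℝ (Fin d) => ⌊2 ^ J * z k⌋₊ :=
    Nat.measurable_floor.comp (by fun_prop)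
  exact h1.min measurable_const

theorem cellIndex_bounds {d : ℕ} (J : ℕ) {z : EuclideanSpace ℝ (Fin d)} (hz : z ∈ unitCube d)
    (k : Fin d) : (cellIndex J z k : ℝ) ≤ 2 ^ J * z k ∧ 2 ^ J * z k ≤ cellIndex J z k + 1 := by
  obtain ⟨h0, h1⟩ := hz k
  have hnn : 0 ≤ 2 ^ J * z k := by positivity
  constructor
  · exact (Nat.cast_le.2 (min_le_left _ _)).trans (Nat.floor_le hnn)
  · rw [cellIndex]
    rcases min_cases ⌊2 ^ J * z k⌋₊ (2 ^ J - 1) with ⟨h, _⟩ | ⟨h, _⟩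
    · rw [h]
      exact (Nat.lt_floor_add_one _).le
    · rw [h]
      have : (1 : ℕ) ≤ 2 ^ J := Nat.one_le_two_pow
      push_cast [this]
      have : (2 : ℝ) ^ J * z k ≤ 2 ^ J * 1 := by gcongr
      linarith

theorem norm_sub_le_of_nearby_cells {d : ℕ} (J : ℕ) {z z' : EuclideanSpace ℝ (Fin d)}
    (hz : z ∈ unitCube d) (hz' : z' ∈ unitCube d)
    (h : ∀ k, cellIndex J z k ≤ cellIndex J z' k + 1 ∧ cellIndex J z' k ≤ cellIndex J z k + 1) :
    ‖z - z'‖ ≤ d * (2 * (1 / 2) ^ J) := by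
  refine norm_sub_le_of_forall_abs_le (by positivity) fun k => ?_
  obtain ⟨a1, a2⟩ := cellIndex_bounds J hz k
  obtain ⟨b1, b2⟩ := cellIndex_bounds J hz' k
  have h1 : (cellIndex J z k : ℝ) ≤ cellIndex J z' k + 1 := by exact_mod_cast (h k).1
  have h2 : (cellIndex J z' k : ℝ) ≤ cellIndex J z k + 1 := by exact_mod_cast (h k).2
  have hpos : (0 : ℝ) < 2 ^ J := by positivity
  rw [one_div, inv_pow, ← div_eq_mul_inv, le_div_iff₀ hpos, ← abs_of_pos hpos, ← abs_mul,
    abs_le]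
  constructor <;> linarith

theorem norm_sub_le_of_cellIndex_eq {d : ℕ} (J : ℕ) {z z' : EuclideanSpace ℝ (Fin d)}
    (hz : z ∈ unitCube d) (hz' : z' ∈ unitCube d) (h : cellIndex J z = cellIndex J z') :
    ‖z - z'‖ ≤ d * (1 / 2) ^ J := by
  refine norm_sub_le_of_forall_abs_le (by positivity) fun k => ?_
  obtain ⟨a1, a2⟩ := cellIndex_bounds J hz k
  obtain ⟨b1, b2⟩ := cellIndex_bounds J hz' k
  rw [h] at a1 a2
  have hpos : (0 : ℝ) < 2 ^ J := by positivity
  rw [one_div, inv_pow, inv_eq_one_div, le_div_iff₀ hpos, ← abs_of_pos hpos, ← abs_mul,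
    abs_le]
  constructor <;> linarith

theorem cellIndex_le_of_norm_sub_le {d : ℕ} (J : ℕ) {z z' : EuclideanSpace ℝ (Fin d)}
    (hz : z ∈ unitCube d) (hz' : z' ∈ unitCube d) {D : ℕ}
    (h : ‖z - z'‖ * 2 ^ J + 1 ≤ D) (k : Fin d) : cellIndex J z k ≤ cellIndex J z' k + D := by
  have h1 := (cellIndex_bounds J hz k).1
  have h2 := (cellIndex_bounds J hz' k).2
  have h3 := (le_abs_self _).trans (abs_sub_apply_le_norm z z' k)
  have h4 : (z k - z' k) * 2 ^ J ≤ ‖z - z'‖ * 2 ^ J := by gcongr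
  have : (cellIndex J z k : ℝ) ≤ cellIndex J z' k + D := by linarith
  exact_mod_cast this

/-- The centre of the dyadic cell `b`. -/
noncomputable def cellCenter {d : ℕ} (J : ℕ) (b : Fin d → ℕ) : EuclideanSpace ℝ (Fin d) :=
  WithLp.toLp 2 fun k => (b k + 1 / 2) * (1 / 2) ^ J

theorem cellCenter_mem_unitCube {d : ℕ} {J : ℕ} {b : Fin d → ℕ} (hb : b ∈ box fun _ => 2 ^ J) :
    cellCenter J b ∈ unitCube d := by
  intro k
  have hk : (b k : ℝ) + 1 ≤ 2 ^ J := by exact_mod_cast mem_box.1 hb k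
  simp only [cellCenter]
  refine ⟨by positivity, ?_⟩
  rw [one_div_pow, mul_one_div, div_le_one (by positivity)]
  linarith

theorem cellIndex_eq_of_norm_sub_cellCenter_le {d : ℕ} {J : ℕ} {b : Fin d → ℕ}
    (hb : b ∈ box fun _ => 2 ^ J) {z : EuclideanSpace ℝ (Fin d)}
    (h : ‖z - cellCenter J b‖ ≤ (1 / 2) ^ J / 4) : cellIndex J z = b := by
  funext k
  have hk : b k < 2 ^ J := mem_box.1 hb k
  have h1 := (abs_sub_apply_le_norm z (cellCenter J b) k).trans h
  simp only [cellCenter] at h1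
  have hpos : (0 : ℝ) < 2 ^ J := by positivity
  have h2 : |2 ^ J * z k - (b k + 1 / 2)| ≤ 1 / 4 := by
    have : 2 ^ J * z k - (b k + 1 / 2) = 2 ^ J * (z k - (b k + 1 / 2) * (1 / 2) ^ J) := by
      rw [one_div_pow]
      field_simp
    rw [this, abs_mul, abs_of_pos hpos]
    calc _ ≤ 2 ^ J * ((1 / 2 : ℝ) ^ J / 4) := by gcongr
      _ = 1 / 4 := by
        rw [one_div_pow]
        field_simp
  obtain ⟨h3, h4⟩ := abs_le.1 h2
  have h5 : ⌊2 ^ J * z k⌋₊ = b k := by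
    have : (0 : ℝ) ≤ b k := Nat.cast_nonneg _
    rw [Nat.floor_eq_iff (by linarith)]
    constructor <;> linarith
  rw [cellIndex, h5]
  omega

theorem withDensity_le_mul {X : Type*} [MeasurableSpace X] {μ : Measure X} {p : X → ℝ}
    {s : Set X} (hs : MeasurableSet s) {B : ℝ}
    (hp : ∀ t, p t ≤ B) :
    μ.withDensity (fun t => ENNReal.ofReal (p t)) s ≤ ENNReal.ofReal B * μ s := by
  rw [withDensity_apply _ hs, ← setLIntegral_const]
  exact lintegral_mono fun t => ENNReal.ofReal_le_ofReal (hp t)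

theorem mul_le_withDensity {X : Type*} [MeasurableSpace X] {μ : Measure X} {p : X → ℝ}
    {s : Set X} (hs : MeasurableSet s) {B : ℝ}
    (hp : ∀ t, B ≤ p t) :
    ENNReal.ofReal B * μ s ≤ μ.withDensity (fun t => ENNReal.ofReal (p t)) s := by
  rw [withDensity_apply _ hs, ← setLIntegral_const]
  exact lintegral_mono fun t => ENNReal.ofReal_le_ofReal (hp t)

/-- The constant in the lower bound for the probability of a cell of side `w`, of order `w ^ d`. -/
noncomputable def lowerProb (c : Constants) : ℝ := c.pmin * c.c1 * (1 / (4 * c.Lmax)) ^ c.d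

/-- The constant in the upper bound for the probability of a cell of side `w`, of order `w ^ d`.
The maximum makes it positive for all values of the constants. -/
noncomputable def upperProb (c : Constants) : ℝ := max c.pmax 1 * c.c2 * (c.d / c.Lmin) ^ c.d

theorem lowerProb_pos (c : Constants) : 0 < lowerProb c := by
  have h1 := c.pmin_pos
  have h2 := c.c1_pos
  have h3 := c.Lmax_pos
  unfold lowerProb
  positivity

theorem upperProb_pos (c : Constants) : 0 < upperProb c := by
  have h1 : 0 < max c.pmax 1 := lt_max_of_lt_right one_pos
  have h2 := c.c2_pos
  have h3 := c.Lmin_pos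
  have h4 : (0 : ℝ) < c.d := by exact_mod_cast lt_of_lt_of_le two_pos c.two_le_d
  unfold upperProb
  positivity

/-- The probability of a dyadic cell of side `2⁻ᴶ` is of the order of its volume `2⁻ᵈᴶ`. -/
theorem cell_prob_bounds {c : Constants} {X : Type*} [MetricSpace X] [MeasurableSpace X]
    [BorelSpace X] {μ : Measure X} {p : X → ℝ} (hD : DesignAssumptions c μ p)
    {h : X ≃ₜ unitCube c.d}
    (hh : ∀ t t' : X, c.Lmin * dist t t' ≤ ‖(h t : EuclideanSpace ℝ (Fin c.d)) - h t'‖ ∧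
      ‖(h t : EuclideanSpace ℝ (Fin c.d)) - h t'‖ ≤ c.Lmax * dist t t') {J : ℕ}
    (h1 : (1 / 2) ^ J / (4 * c.Lmax) < c.r0) (h2 : c.d * (1 / 2) ^ J / c.Lmin < c.r0)
    {b : Fin c.d → ℕ} (hb : b ∈ box fun _ => 2 ^ J) :
    ENNReal.ofReal (lowerProb c / 2 ^ (c.d * J))
        ≤ μ.withDensity (fun t => ENNReal.ofReal (p t)) {t | cellIndex J (h t).1 = b} ∧
      μ.withDensity (fun t => ENNReal.ofReal (p t)) {t | cellIndex J (h t).1 = b}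
        ≤ ENNReal.ofReal (upperProb c / 2 ^ (c.d * J)) := by
  have hLmin := c.Lmin_pos
  have hLmax := c.Lmax_pos
  have hd : 0 < c.d := lt_of_lt_of_le two_pos c.two_le_d
  have hdR : (0 : ℝ) < c.d := by exact_mod_cast hd
  have hm : MeasurableSet {t | cellIndex J (h t).1 = b} := by
    have : Measurable fun t => cellIndex J (h t).1 :=
      (measurable_cellIndex J).comp (continuous_subtype_val.comp h.continuous).measurable
    exact this (measurableSet_singleton b)
  set t₀ : X := h.symm ⟨cellCenter J b, cellCenter_mem_unitCube hb⟩ with ht₀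
  have hht₀ : (h t₀).1 = cellCenter J b := by rw [ht₀, Homeomorph.apply_symm_apply]
  have hin : Metric.closedBall t₀ ((1 / 2) ^ J / (4 * c.Lmax)) ⊆ {t | cellIndex J (h t).1 = b} := by
    intro t ht
    refine cellIndex_eq_of_norm_sub_cellCenter_le hb ?_
    rw [← hht₀]
    refine (hh t t₀).2.trans ?_
    calc _ ≤ c.Lmax * ((1 / 2) ^ J / (4 * c.Lmax)) := by
          gcongr
          exact ht
      _ = _ := by field_simp
  have ht₀mem : cellIndex J (h t₀).1 = b :=
    hin (Metric.mem_closedBall_self (by positivity))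
  have hout : {t | cellIndex J (h t).1 = b} ⊆
      Metric.closedBall t₀ (c.d * (1 / 2) ^ J / c.Lmin) := by
    intro t ht
    have ht' : cellIndex J (h t).1 = b := ht
    have := norm_sub_le_of_cellIndex_eq J (h t).2 (h t₀).2 (ht'.trans ht₀mem.symm)
    rw [Metric.mem_closedBall, le_div_iff₀ hLmin, mul_comm]
    exact (hh t t₀).1.trans this
  have hpow : (2 : ℝ) ^ (c.d * J) = (2 ^ J) ^ c.d := by rw [← pow_mul, mul_comm]
  have hpmax : 0 ≤ max c.pmax 1 := le_max_of_le_right zero_le_one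
  constructor
  · refine le_trans ?_ (mul_le_withDensity hm fun t => (hD.bounded_density t).1.le)
    calc _ = ENNReal.ofReal c.pmin
          * ENNReal.ofReal (c.c1 * ((1 / 2) ^ J / (4 * c.Lmax)) ^ c.d) := by
          rw [← ENNReal.ofReal_mul c.pmin_pos.le, hpow, lowerProb]
          congr 1
          rw [div_pow, div_pow, one_div_pow, one_div_pow, one_pow]
          field_simp
      _ ≤ _ := by
          gcongr
          exact (hD.ball_volume t₀ _ (by positivity) h1).1.trans (measure_mono hin)
  · refine (withDensity_le_mul hm fun t => (hD.bounded_density t).2.le.trans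
      (le_max_left _ 1)).trans ?_
    calc _ ≤ ENNReal.ofReal (max c.pmax 1)
          * ENNReal.ofReal (c.c2 * (c.d * (1 / 2) ^ J / c.Lmin) ^ c.d) := by
          gcongr
          exact (measure_mono hout).trans (hD.ball_volume t₀ _ (by positivity) h2).2
      _ = _ := by
          rw [← ENNReal.ofReal_mul hpmax, hpow, upperProb]
          congr 1
          simp only [div_pow, mul_pow, one_pow]
          field_simp

/-- The number of sample points whose cells are at most `D` steps away in every direction. -/
theorem card_filter_window_le {d n : ℕ} (cell : Fin n → Fin d → ℕ) {M : ℝ}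
    (hM : ∀ b, ((Finset.univ.filter (cell · = b)).card : ℝ) ≤ M) (D : ℕ) (b : Fin d → ℕ)
    (I : Finset (Fin n)) (hI : ∀ i ∈ I, ∀ k, cell i k ≤ b k + D ∧ b k ≤ cell i k + D) :
    (I.card : ℝ) ≤ (2 * D + 1) ^ d * M := by
  classical
  set W : Finset (Fin d → ℕ) := Fintype.piFinset fun k => Finset.Icc (b k - D) (b k + D) with hW
  have hsub : I ⊆ W.biUnion fun b' => Finset.univ.filter (cell · = b') := by
    intro i hi
    simp only [Finset.mem_biUnion, Finset.mem_filter, Finset.mem_univ, true_and, hW,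
      Fintype.mem_piFinset, Finset.mem_Icc]
    refine ⟨cell i, fun k => ?_, rfl⟩
    have := hI i hi k
    omega
  have hM0 : 0 ≤ M := (Nat.cast_nonneg _).trans (hM b)
  have hWcard : W.card ≤ (2 * D + 1) ^ d := by
    rw [hW, Fintype.card_piFinset]
    calc _ ≤ ∏ _k : Fin d, (2 * D + 1) := Finset.prod_le_prod' fun k _ => by
          rw [Nat.card_Icc]
          omega
      _ = _ := by simp
  have h1 : (I.card : ℝ) ≤ ∑ b' ∈ W, ((Finset.univ.filter (cell · = b')).card : ℝ) := by
    exact_mod_cast (Finset.card_le_card hsub).trans Finset.card_biUnion_le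
  calc (I.card : ℝ) ≤ ∑ b' ∈ W, M := h1.trans (Finset.sum_le_sum fun b' _ => hM b')
    _ = W.card * M := by rw [Finset.sum_const, nsmul_eq_mul]
    _ ≤ _ := by
        gcongr
        exact_mod_cast hWcard

/-! ### The exceptional event and the choice of scale -/

/-- The cells of the sample points. -/
noncomputable def sampleCell {d n : ℕ} {X : Type*} [TopologicalSpace X] (h : X ≃ₜ unitCube d)
    (J : ℕ) (z : Fin n → X) (i : Fin n) : Fin d → ℕ :=
  cellIndex J (h (z i)).1

/-- The regularity of a sample on which the deterministic argument rests: every cell holds between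
`m` and `M` points, and the sums of the errors over single points and over blocks of cells are at
most `a` times the square root of the number of terms. -/
structure IsRegularSample {d n : ℕ} (hd : 2 ≤ d) (J : ℕ) (cell : Fin n → Fin d → ℕ)
    (e : Fin n → ℝ) (m M a : ℝ) : Prop where
  le_card : ∀ b ∈ box (fun _ : Fin d => 2 ^ J), m ≤ (Finset.univ.filter (cell · = b)).card
  card_le : ∀ b ∈ box (fun _ : Fin d => 2 ^ J), ((Finset.univ.filter (cell · = b)).card : ℝ) ≤ M
  abs_le : ∀ i, |e i| ≤ a
  abs_sum_le : ∀ s ≤ d * J, ∀ b, |∑ i ∈ block (cyclicDir d hd) cell s b, e i|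
    ≤ a * √(block (cyclicDir d hd) cell s b).card

/-- Outside an event of small probability the sample is regular. The blocks of stage `s` are indexed
by all cells `z` of the original grid through `coarsen dir s z`; this counts blocks repeatedly,
which is harmless, and leaves out only blocks without sample points. -/
theorem exists_exceptional_event {c : Constants} {X : Type*} [MetricSpace X] [MeasurableSpace X]
    [BorelSpace X] {μ : Measure X} {p : X → ℝ} (hD : DesignAssumptions c μ p)
    {h : X ≃ₜ unitCube c.d}
    (hh : ∀ t t' : X, c.Lmin * dist t t' ≤ ‖(h t : EuclideanSpace ℝ (Fin c.d)) - h t'‖ ∧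
      ‖(h t : EuclideanSpace ℝ (Fin c.d)) - h t'‖ ≤ c.Lmax * dist t t') {J : ℕ}
    (h1 : (1 / 2) ^ J / (4 * c.Lmax) < c.r0) (h2 : c.d * (1 / 2) ^ J / c.Lmin < c.r0)
    {Ω : Type*} [MeasurableSpace Ω] {P : Measure Ω} [IsProbabilityMeasure P] {n : ℕ}
    {x : Fin n → Ω → X} {ξ : Fin n → Ω → ℝ} (hS : SampleAssumptions c μ p P x ξ)
    {a : ℝ} (ha : 0 ≤ a) :
    ∃ Bad : Set Ω,
      P Bad ≤ ENNReal.ofReal (2 ^ (c.d * J) * (Real.exp (-(n * (lowerProb c / 2 ^ (c.d * J)) / 4))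
          + Real.exp (-(n * (upperProb c / 2 ^ (c.d * J)))))
        + (n + (c.d * J + 1) * 2 ^ (c.d * J))
          * (2 * Real.exp (-a ^ 2 / (2 * (4 * c.σ ^ 2 * (1 + 2 * c.C)))))) ∧
      ∀ ω, ω ∉ Bad → IsRegularSample c.two_le_d J (sampleCell h J fun i => x i ω)
        (fun i => ξ i ω) (n * (lowerProb c / 2 ^ (c.d * J)) / 4)
        (3 * (n * (upperProb c / 2 ^ (c.d * J)))) a := by
  classical
  set dir := cyclicDir c.d c.two_le_d with hdir
  set u := lowerProb c / 2 ^ (c.d * J) with hu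
  set w := upperProb c / 2 ^ (c.d * J) with hw
  have hu0 : 0 ≤ u := by have := lowerProb_pos c; positivity
  set v : NNReal := (4 * c.σ ^ 2 * (1 + 2 * c.C)).toNNReal with hv
  have hσ := c.σ_pos
  have hC := c.C_pos
  have hvr : (v : ℝ) = 4 * c.σ ^ 2 * (1 + 2 * c.C) := Real.coe_toNNReal _ (by positivity)
  have hv0 : 0 < v := by rw [← NNReal.coe_pos, hvr]; positivity
  rw [← hvr]
  set τ := 2 * Real.exp (-a ^ 2 / (2 * v)) with hτ
  have hτ0 : 0 ≤ τ := by positivity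
  have hsub : ∀ i, HasSubgaussianMGF (ξ i) v P := fun i =>
    hasSubgaussianMGF_of_tail (hS.measurable_error i) (hS.integrable_error i) (hS.mean_zero i)
      hC.le hσ (hS.sub_gaussian i)
  set L : Fin c.d → ℕ := fun _ => 2 ^ J with hL
  have hcardL : (box L).card = 2 ^ (c.d * J) := by
    rw [hL, card_box_const, ← pow_mul, mul_comm]
  have hcm : Measurable fun t => cellIndex J (h t).1 :=
    (measurable_cellIndex J).comp (continuous_subtype_val.comp h.continuous).measurable
  -- the exceptional events: a bad cell count, a large error, a large sum of errors over a block
  set Bc : (Fin c.d → ℕ) → Set Ω := fun b =>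
    {ω | ((Finset.univ.filter fun i => x i ω ∈ {t | cellIndex J (h t).1 = b}).card : ℝ)
        < n * u / 4 ∨ 3 * (n * w)
        < ((Finset.univ.filter fun i => x i ω ∈ {t | cellIndex J (h t).1 = b}).card : ℝ)} with hBc
  set Be : Fin n → Set Ω := fun j => {ω | a * √(({j} : Finset (Fin n)).card)
    < |∑ i ∈ ({j} : Finset (Fin n)), ξ i ω|} with hBe
  set Bb : ℕ × (Fin c.d → ℕ) → Set Ω := fun q =>
    {ω | a * √(block dir (sampleCell h J fun i => x i ω) q.1 (coarsen dir q.1 q.2)).card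
      < |∑ i ∈ block dir (sampleCell h J fun i => x i ω) q.1 (coarsen dir q.1 q.2), ξ i ω|} with hBb
  have hPc : ∀ b ∈ box L, P (Bc b) ≤ ENNReal.ofReal
      (Real.exp (-(n * u / 4)) + Real.exp (-(n * w))) := by
    intro b hb
    have hm : MeasurableSet {t | cellIndex J (h t).1 = b} := hcm (measurableSet_singleton b)
    obtain ⟨p1, p2⟩ := cell_prob_bounds hD hh h1 h2 hb
    set ν := μ.withDensity fun t => ENNReal.ofReal (p t) with hν
    have hw0 : 0 ≤ w := by have := upperProb_pos c; positivity
    refine measure_card_filter_le hS.measurable_covariate hS.indep_covariates hm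
      (q := (ν {t | cellIndex J (h t).1 = b}).toReal) (fun i => ?_) ?_ ?_ hu0
    · rw [hν, ← hS.law_covariate i, Measure.map_apply (hS.measurable_covariate i) hm]
      rfl
    · exact (ENNReal.ofReal_le_iff_le_toReal (p2.trans_lt ENNReal.ofReal_lt_top).ne).1 p1
    · exact ENNReal.toReal_le_of_le_ofReal hw0 p2
  have hPe : ∀ j, P (Be j) ≤ ENNReal.ofReal τ := fun j =>
    measure_sqrt_card_lt_abs_sum_le hS.indep_errors hv0 hsub ha {j}
  have hPb : ∀ q, P (Bb q) ≤ ENNReal.ofReal τ := by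
    intro q
    refine measure_sqrt_card_lt_abs_sum_random_le hS.measurable_covariate hS.indep_errors
      hS.indep_errors_covariates hv0 hsub ha
      (fun z => block dir (sampleCell h J z) q.1 (coarsen dir q.1 q.2)) fun s => ?_
    have hmeas : Measurable fun z : Fin n → X => sampleCell h J z :=
      measurable_pi_lambda _ fun i => hcm.comp (measurable_pi_apply i)
    have hset : MeasurableSet {f : Fin n → Fin c.d → ℕ |
        block dir f q.1 (coarsen dir q.1 q.2) = s} := (Set.to_countable _).measurableSet
    exact hmeas hset
  clear_value τ
  set T : Finset (ℕ × (Fin c.d → ℕ)) := Finset.range (c.d * J + 1) ×ˢ box L with hT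
  refine ⟨(⋃ b ∈ box L, Bc b) ∪ ((⋃ j ∈ Finset.univ, Be j) ∪ ⋃ q ∈ T, Bb q), ?_, ?_⟩
  · have e1 : P (⋃ b ∈ box L, Bc b) ≤ ENNReal.ofReal
        (2 ^ (c.d * J) * (Real.exp (-(n * u / 4)) + Real.exp (-(n * w)))) := by
      refine (measure_biUnion_finset_le _ _).trans ((Finset.sum_le_sum hPc).trans_eq ?_)
      rw [Finset.sum_const, hcardL, nsmul_eq_mul, ENNReal.ofReal_mul (by positivity)]
      congr 1
      rw [ENNReal.ofReal_pow (by norm_num)]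
      simp
    have e2 : P (⋃ j ∈ Finset.univ, Be j) ≤ ENNReal.ofReal (n * τ) := by
      refine (measure_biUnion_finset_le _ _).trans
        ((Finset.sum_le_sum fun j _ => hPe j).trans_eq ?_)
      rw [Finset.sum_const, Finset.card_univ, Fintype.card_fin, nsmul_eq_mul,
        ENNReal.ofReal_mul (by positivity), ENNReal.ofReal_natCast]
    have e3 : P (⋃ q ∈ T, Bb q) ≤ ENNReal.ofReal (((c.d * J + 1) * 2 ^ (c.d * J)) * τ) := by
      refine (measure_biUnion_finset_le _ _).trans
        ((Finset.sum_le_sum fun q _ => hPb q).trans_eq ?_)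
      rw [Finset.sum_const, hT, Finset.card_product, Finset.card_range, hcardL, nsmul_eq_mul,
        ENNReal.ofReal_mul (by positivity), ← ENNReal.ofReal_natCast]
      congr 2
      push_cast
      ring
    rw [add_mul, ENNReal.ofReal_add (by positivity) (by positivity),
      ENNReal.ofReal_add (by positivity) (by positivity)]
    exact (measure_union_le _ _).trans
      (add_le_add e1 ((measure_union_le _ _).trans (add_le_add e2 e3)))
  · intro ω hω
    simp only [Set.mem_union, Set.mem_iUnion, not_or, not_exists] at hω
    obtain ⟨w1, w2, w3⟩ := hω
    have hcount : ∀ b ∈ box L, ¬ (_ ∨ _) := w1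
    refine ⟨fun b hb => ?_, fun b hb => ?_, fun i => ?_, fun s hs b => ?_⟩
    · exact not_lt.1 (not_or.1 (hcount b hb)).1
    · exact not_lt.1 (not_or.1 (hcount b hb)).2
    · have hi : ¬ (a * √(({i} : Finset (Fin n)).card) < |∑ j ∈ ({i} : Finset (Fin n)), ξ j ω|) :=
        w2 i (Finset.mem_univ i)
      simpa using not_lt.1 hi
    · by_cases hne : ∃ z ∈ box L, coarsen dir s z = b
      · obtain ⟨z, hz, rfl⟩ := hne
        have hq : ω ∉ Bb (s, z) := w3 (s, z)
          (Finset.mem_product.2 ⟨Finset.mem_range.2 (by omega), hz⟩)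
        exact not_lt.1 hq
      · have hemp : block dir (sampleCell h J fun i => x i ω) s b = ∅ := by
          refine Finset.eq_empty_of_forall_notMem fun i hi => hne ?_
          exact ⟨_, cellIndex_mem_box J _, mem_block.1 hi⟩
        rw [hemp]
        simp

theorem exists_two_pow_mul_between {d : ℕ} (hd : 0 < d) {y : ℝ} (hy : 1 ≤ y) :
    ∃ J : ℕ, y ≤ 2 ^ (d * J) ∧ (2 : ℝ) ^ (d * J) ≤ 2 ^ d * y := by
  obtain ⟨k, hk1, hk2⟩ := exists_nat_pow_near hy (one_lt_pow₀ (one_lt_two (α := ℝ)) hd.ne')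
  refine ⟨k + 1, ?_, ?_⟩
  · rw [pow_mul]
    exact hk2.le
  · rw [pow_mul, pow_succ, mul_comm]
    gcongr

/-- The scale at which a cell holds about `log ^ (1 + 2 r) n` points. -/
theorem eventually_exists_scale {d : ℕ} (hd : 0 < d) {r : ℝ} (hr : 0 < r) {κ B w₀ : ℝ}
    (hκ : 0 < κ) (hB : 0 < B) (hw₀ : 0 < w₀) :
    ∀ᶠ n : ℕ in atTop, 1 ≤ Real.log n ∧ B ≤ Real.log n ∧
      B * Real.log n ≤ Real.log n ^ (1 + 2 * r) ∧ B ≤ n ∧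
      ∃ J : ℕ, κ / 2 ^ d * Real.log n ^ (1 + 2 * r) ≤ n / 2 ^ (d * J) ∧
        n / 2 ^ (d * J) ≤ κ * Real.log n ^ (1 + 2 * r) ∧ (2 : ℝ) ^ (d * J) ≤ n ∧
        (1 / 2 : ℝ) ^ J ≤ w₀ := by
  have hlog : Tendsto (fun n : ℕ => Real.log n) atTop atTop :=
    Real.tendsto_log_atTop.comp tendsto_natCast_atTop_atTop
  have hpow : Tendsto (fun n : ℕ => Real.log n ^ (2 * r)) atTop atTop :=
    (tendsto_rpow_atTop (by linarith)).comp hlog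
  have hsmall : Tendsto (fun n : ℕ => Real.log n ^ (1 + 2 * r) / n) atTop (nhds 0) := by
    have h1 := (isLittleO_log_rpow_rpow_atTop (1 + 2 * r) one_pos).tendsto_div_nhds_zero
    simpa [Function.comp_def] using h1.comp tendsto_natCast_atTop_atTop
  filter_upwards [hlog.eventually_ge_atTop 1, hlog.eventually_ge_atTop B,
    hpow.eventually_ge_atTop B, hpow.eventually_ge_atTop (2 ^ d / κ),
    tendsto_natCast_atTop_atTop.eventually_ge_atTop B,
    hsmall.eventually (gt_mem_nhds (show 0 < 1 / κ by positivity)),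
    hsmall.eventually (gt_mem_nhds (show 0 < w₀ ^ d / κ by positivity)),
    eventually_ge_atTop 1] with n h1 h2 h3 h4 h5 h6 h7 h8
  have hℓ : 0 < Real.log n := by linarith
  have hn : (0 : ℝ) < n := by exact_mod_cast h8
  have hN : Real.log n ^ (1 + 2 * r) = Real.log n * Real.log n ^ (2 * r) := by
    rw [Real.rpow_add hℓ, Real.rpow_one]
  set N := Real.log n ^ (1 + 2 * r) with hNdef
  have hN0 : 0 < N := by positivity
  refine ⟨h1, h2, ?_, h5, ?_⟩
  · rw [hN, mul_comm]
    gcongr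
  · obtain ⟨J, hJ1, hJ2⟩ := exists_two_pow_mul_between hd (y := n / (κ * N)) (by
      rw [div_lt_div_iff₀ hn hκ] at h6
      rw [le_div_iff₀ (by positivity)]
      linarith)
    have hp : (0 : ℝ) < 2 ^ (d * J) := by positivity
    have hup : n / 2 ^ (d * J) ≤ κ * N := by
      rw [div_le_iff₀ (by positivity)] at hJ1
      rw [div_le_iff₀ hp]
      linarith
    have hlo : κ / 2 ^ d * N ≤ n / 2 ^ (d * J) := by
      rw [le_div_iff₀ hp]
      calc κ / 2 ^ d * N * 2 ^ (d * J) ≤ κ / 2 ^ d * N * (2 ^ d * (n / (κ * N))) := by gcongr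
        _ = n := by field_simp
    refine ⟨J, hlo, hup, ?_, ?_⟩
    · have : 1 ≤ κ / 2 ^ d * N := by
        rw [div_le_iff₀ hκ] at h4
        rw [div_mul_eq_mul_div, le_div_iff₀ (by positivity), hN]
        have h10 : 1 * Real.log n ^ (2 * r) ≤ Real.log n * Real.log n ^ (2 * r) := by gcongr
        have h11 := mul_le_mul_of_nonneg_left h10 hκ.le
        linarith
      have h9 := this.trans hlo
      rw [le_div_iff₀ hp] at h9
      linarith
    · refine le_of_pow_le_pow_left₀ hd.ne' hw₀.le ?_
      rw [← pow_mul, mul_comm J d, one_div_pow, div_le_iff₀ hp]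
      rw [div_lt_div_iff₀ hn hκ] at h7
      rw [div_le_iff₀ hp] at hup
      nlinarith

/-- The oracle inequality on a regular sample, in terms of the sample size and the scale. -/
theorem sum_sq_sub_le_of_isRegularSample {d n : ℕ} (hd : 2 ≤ d) {G : SimpleGraph (Fin n)}
    {J : ℕ} {cell : Fin n → Fin d → ℕ} (hG : JoinsNearbyCells G cell)
    (hcell : ∀ i, cell i ∈ box fun _ => 2 ^ J) {θ e θhat : Fin n → ℝ} {m M a : ℝ} (hm : 0 < m)
    (hM : 0 ≤ M) (ha : 0 ≤ a) (hreg : IsRegularSample hd J cell e m M a) {lam : ℝ}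
    (hlam : 2 * a / m + (d * J) * (2 * a * √M / m ^ 2) ≤ lam)
    (hθ : IsFusedLasso (fun i => θ i + e i) G lam θhat) :
    ∑ i, (θhat i - θ i) ^ 2 ≤ 4 * (a ^ 2 * n / (2 ^ (d * J) * m)) + 8 * lam * graphTV G θ := by
  have h0 : 0 ≤ lam := le_trans (by positivity) hlam
  have h1 := abs_sum_noise_mul_le hd hG J hcell hm hM hreg.le_card hreg.card_le e
    (fun i => θhat i - θ i) ha hreg.abs_le hreg.abs_sum_le
  have h2 := sum_sq_sub_le_of_isFusedLasso (B := √(a ^ 2 * n / (2 ^ (d * J) * m))) h0 hθ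
    (((le_abs_self _).trans h1).trans (by
      gcongr
      exact graphTV_nonneg _ _))
  rwa [Real.sq_sqrt (by positivity)] at h2

/-! ### The rate, for all graphs that join nearby cells -/

/-- At cell counts of order `N ≥ ℓ = log n`, the penalty required by the noise stays bounded. -/
theorem required_penalty_le {ℓ N m M V α β k : ℝ} (hℓ : 1 ≤ ℓ) (hN : ℓ ≤ N) (hα : 0 < α)
    (hβ : 0 < β) (hm : α * N ≤ m) (hM : M ≤ β * N) (hk : k ≤ 2 * ℓ) (hV : 0 ≤ V) :
    2 * √(V * ℓ) / m + k * (2 * √(V * ℓ) * √M / m ^ 2) ≤ 2 * √V / α + 4 * (√V * √β) / α ^ 2 := by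
  have hN0 : 0 < N := by linarith
  have hsℓ : √ℓ ≤ N := (Real.sqrt_le_left (by linarith)).2 (by nlinarith) |>.trans hN
  have hsN : √ℓ * √N ≤ N := by
    calc √ℓ * √N ≤ √N * √N := by gcongr
      _ = N := Real.mul_self_sqrt hN0.le
  have hsM : √M ≤ √β * √N := by
    rw [← Real.sqrt_mul hβ.le]
    exact Real.sqrt_le_sqrt hM
  rw [Real.sqrt_mul hV]
  gcongr ?_ + ?_
  · calc 2 * (√V * √ℓ) / m ≤ 2 * (√V * N) / (α * N) := by gcongr
      _ = 2 * √V / α := by field_simp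
  · calc k * (2 * (√V * √ℓ) * √M / m ^ 2)
        ≤ (2 * N) * (2 * (√V * √ℓ) * (√β * √N) / (α * N) ^ 2) := by
          gcongr
          linarith
      _ = (2 * N) * (2 * (√V * √β) * (√ℓ * √N) / (α * N) ^ 2) := by ring
      _ ≤ (2 * N) * (2 * (√V * √β) * N / (α * N) ^ 2) := by gcongr
      _ = 4 * (√V * √β) / α ^ 2 := by field_simp; ring

theorem exceptional_prob_le {n q k A₁ A₂ τ : ℝ} (hn : 1 ≤ n) (hq : 0 ≤ q) (hqn : q ≤ n)
    (hkq : k + 1 ≤ q) (hA₁ : 2 * Real.log n ≤ A₁) (hA₂ : 2 * Real.log n ≤ A₂)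
    (hτ : 4 * Real.log n ≤ τ) :
    q * (Real.exp (-A₁) + Real.exp (-A₂)) + (n + (k + 1) * q) * (2 * Real.exp (-τ)) ≤ 6 / n := by
  have hn0 : 0 < n := by linarith
  have h2 : Real.exp (-(2 * Real.log n)) = 1 / n ^ 2 := by
    rw [Real.exp_neg, mul_comm, Real.exp_mul, Real.exp_log hn0, one_div]
    norm_cast
  have h4 : Real.exp (-(4 * Real.log n)) = 1 / n ^ 4 := by
    rw [Real.exp_neg, mul_comm, Real.exp_mul, Real.exp_log hn0, one_div]
    norm_cast
  have e1 : Real.exp (-A₁) ≤ 1 / n ^ 2 := h2 ▸ Real.exp_le_exp.2 (by linarith)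
  have e2 : Real.exp (-A₂) ≤ 1 / n ^ 2 := h2 ▸ Real.exp_le_exp.2 (by linarith)
  have e3 : Real.exp (-τ) ≤ 1 / n ^ 4 := h4 ▸ Real.exp_le_exp.2 (by linarith)
  have e4 : n + (k + 1) * q ≤ 2 * n ^ 2 := by
    have : (k + 1) * q ≤ n * n := by
      calc (k + 1) * q ≤ q * q := by gcongr
        _ ≤ n * n := by gcongr
    nlinarith
  calc _ ≤ n * (1 / n ^ 2 + 1 / n ^ 2) + 2 * n ^ 2 * (2 * (1 / n ^ 4)) := by gcongr
    _ = 2 / n + 4 / n ^ 2 := by field_simp; ring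
    _ ≤ 2 / n + 4 / n := by
        gcongr
        nlinarith
    _ = 6 / n := by ring

theorem natCast_le_two_mul_log {k : ℕ} {t : ℝ} (h : (2 : ℝ) ^ k ≤ t) :
    (k : ℝ) ≤ 2 * Real.log t := by
  have h1 := Real.log_le_log (by positivity) h
  rw [Real.log_pow] at h1
  have h2 := Real.log_two_gt_d9
  have h3 : (0 : ℝ) ≤ k := Nat.cast_nonneg k
  nlinarith

/-- The penalty `log ^ (3/2 + r) n`, increased to `1` where it is smaller. -/
noncomputable def penalty (r : ℝ) (n : ℕ) : ℝ := max 1 (Real.log n ^ (3 / 2 + r))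

theorem penalty_pos (r : ℝ) (n : ℕ) : 0 < penalty r n := lt_max_of_lt_left one_pos

/-- Outside an event of small probability, the fused lasso attains the rate on every graph that
joins all sample points in nearby cells of side of order `(log ^ (1 + 2 r) n / n) ^ (1 / d)`; there
the cells hold `O(log ^ (1 + 2 r) n)` points. -/
theorem exists_rate_bound (c : Constants) {r : ℝ} (hr : 0 < r) {κ : ℝ} (hκ : 0 < κ) :
    ∃ M : ℝ, 0 < M ∧ ∀ η : ℝ, 0 < η → ∀ᶠ n : ℕ in atTop, ∃ J : ℕ, 1 ≤ Real.log n ∧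
      (n : ℝ) / 2 ^ (c.d * J) ≤ κ * Real.log n ^ (1 + 2 * r) ∧
      ∀ (X : Type*) [MetricSpace X] [MeasurableSpace X] [BorelSpace X] (μ : Measure X) (p : X → ℝ)
        (f₀ : X → ℝ) (Ω : Type*) [MeasurableSpace Ω] (P : Measure Ω) [IsProbabilityMeasure P]
        (x : Fin n → Ω → X) (ξ : Fin n → Ω → ℝ),
        DesignAssumptions c μ p → SampleAssumptions c μ p P x ξ → ∀ h : X ≃ₜ unitCube c.d,
        (∀ t t' : X, c.Lmin * dist t t' ≤ ‖(h t : EuclideanSpace ℝ (Fin c.d)) - h t'‖ ∧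
          ‖(h t : EuclideanSpace ℝ (Fin c.d)) - h t'‖ ≤ c.Lmax * dist t t') →
        ∃ Bad : Set Ω, P Bad ≤ ENNReal.ofReal η ∧ ∀ ω, ω ∉ Bad →
          (∀ b ∈ box (fun _ => 2 ^ J),
            ((Finset.univ.filter (sampleCell h J (fun i => x i ω) · = b)).card : ℝ)
              ≤ 3 * upperProb c * κ * Real.log n ^ (1 + 2 * r)) ∧
          ∀ (G : SimpleGraph (Fin n)) (θhat : Fin n → ℝ),
            JoinsNearbyCells G (sampleCell h J fun i => x i ω) →
            IsFusedLasso (fun i => f₀ (x i ω) + ξ i ω) G (penalty r n) θhat →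
            empNormSq (fun i => θhat i - f₀ (x i ω))
              ≤ M * rate r n (graphTV G fun i => f₀ (x i ω)) := by
  have hlp := lowerProb_pos c
  have hup := upperProb_pos c
  have hσ := c.σ_pos
  have hC := c.C_pos
  have hLmin := c.Lmin_pos
  have hLmax := c.Lmax_pos
  have hr0 := c.r0_pos
  have hd : 0 < c.d := lt_of_lt_of_le two_pos c.two_le_d
  have hdR : (0 : ℝ) < c.d := by exact_mod_cast hd
  set v : ℝ := 4 * c.σ ^ 2 * (1 + 2 * c.C) with hv
  have hv0 : 0 < v := by positivity
  set κ₁ := κ / 2 ^ c.d with hκ₁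
  have hκ₁0 : 0 < κ₁ := by positivity
  set α := lowerProb c * κ₁ / 4 with hα
  have hα0 : 0 < α := by positivity
  set β := 3 * upperProb c * κ with hβ
  have hβ0 : 0 < β := by positivity
  set pen := 2 * √(8 * v) / α + 4 * (√(8 * v) * √β) / α ^ 2 with hpen
  have hpen0 : 0 ≤ pen := by positivity
  refine ⟨128 * v / lowerProb c + 8, by positivity, fun η hη => ?_⟩
  set B := 1 + pen + 2 / α + 2 / (upperProb c * κ₁) + 6 / η with hB
  have t1 : 0 < 2 / α := by positivity
  have t2 : 0 < 2 / (upperProb c * κ₁) := by positivity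
  have t3 : 0 < 6 / η := by positivity
  set w₀ := min (2 * c.Lmax * c.r0) (c.Lmin * c.r0 / (2 * c.d)) with hw₀
  have hw₀0 : 0 < w₀ := by positivity
  have hw₀1 : w₀ ≤ 2 * c.Lmax * c.r0 := min_le_left _ _
  have hw₀2 : w₀ ≤ c.Lmin * c.r0 / (2 * c.d) := min_le_right _ _
  filter_upwards [eventually_exists_scale hd hr hκ (show 0 < B by linarith) hw₀0]
    with n ⟨hℓ, hBℓ, hBN, hBn, J, hlo, hhi, hJn, hJw⟩
  refine ⟨J, hℓ, hhi, ?_⟩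
  intro X _ _ _ μ p f₀ Ω _ P _ x ξ hD hS h hh
  set ℓ := Real.log n with hℓdef
  set N := ℓ ^ (1 + 2 * r) with hN
  have hBone : 1 ≤ B := by linarith
  have hBpen : pen ≤ B := by linarith
  have hBα : 2 / α ≤ B := by linarith
  have hBκ : 2 / (upperProb c * κ₁) ≤ B := by linarith
  have hBη : 6 / η ≤ B := by linarith
  clear_value B w₀
  have hn1 : (1 : ℝ) ≤ n := hBone.trans hBn
  have hn0 : (0 : ℝ) < n := by linarith
  have hNℓ : ℓ ≤ N := le_trans (le_mul_of_one_le_left (by linarith) hBone) hBN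
  have hq0 : (0 : ℝ) < 2 ^ (c.d * J) := by positivity
  have hm_eq : (n : ℝ) * (lowerProb c / 2 ^ (c.d * J)) / 4
      = lowerProb c / 4 * (n / 2 ^ (c.d * J)) := by ring
  have hm : α * N ≤ n * (lowerProb c / 2 ^ (c.d * J)) / 4 := by
    rw [hm_eq, hα]
    calc lowerProb c * κ₁ / 4 * N = lowerProb c / 4 * (κ₁ * N) := by ring
      _ ≤ _ := by gcongr
  have hM : 3 * (n * (upperProb c / 2 ^ (c.d * J))) ≤ β * N := by
    calc 3 * (n * (upperProb c / 2 ^ (c.d * J)))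
        = 3 * upperProb c * (n / 2 ^ (c.d * J)) := by ring
      _ ≤ 3 * upperProb c * (κ * N) := by gcongr
      _ = β * N := by rw [hβ]; ring
  have hm0 : 0 < n * (lowerProb c / 2 ^ (c.d * J)) / 4 := by positivity
  have hJ2 : (c.d * J : ℝ) ≤ 2 * ℓ := by
    have := natCast_le_two_mul_log hJn
    push_cast at this
    exact this
  have hw1 : (1 / 2) ^ J / (4 * c.Lmax) < c.r0 := by
    rw [div_lt_iff₀ (by positivity)]
    have h3 := hJw.trans hw₀1
    linarith [mul_pos hLmax hr0]
  have hw2 : c.d * (1 / 2) ^ J / c.Lmin < c.r0 := by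
    have h3 := hJw.trans hw₀2
    rw [le_div_iff₀ (by positivity)] at h3
    rw [div_lt_iff₀ hLmin]
    linarith [mul_pos hLmin hr0]
  set a := √(8 * v * ℓ) with ha
  have ha2 : a ^ 2 = 8 * v * ℓ := Real.sq_sqrt (by positivity)
  have ha0 : 0 ≤ a := Real.sqrt_nonneg _
  obtain ⟨Bad, hBad, hreg⟩ := exists_exceptional_event hD hh hw1 hw2 hS ha0
  rw [← hv, neg_div] at hBad
  clear_value a
  refine ⟨Bad, hBad.trans (ENNReal.ofReal_le_ofReal ?_), fun ω hω => ?_⟩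
  · have hkq : (c.d * J : ℝ) + 1 ≤ 2 ^ (c.d * J) := by
      exact_mod_cast Nat.lt_two_pow_self (n := c.d * J)
    have hA₁ : 2 * ℓ ≤ n * (lowerProb c / 2 ^ (c.d * J)) / 4 := by
      refine le_trans ?_ hm
      have h5 : 2 / α * ℓ ≤ N := le_trans (by gcongr) hBN
      rw [div_mul_eq_mul_div, div_le_iff₀ hα0] at h5
      linarith
    have hA₂ : 2 * ℓ ≤ n * (upperProb c / 2 ^ (c.d * J)) := by
      have h5 : 2 / (upperProb c * κ₁) * ℓ ≤ N := le_trans (by gcongr) hBN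
      rw [div_mul_eq_mul_div, div_le_iff₀ (by positivity)] at h5
      calc 2 * ℓ ≤ upperProb c * (κ₁ * N) := by linarith
        _ ≤ upperProb c * (n / 2 ^ (c.d * J)) := by gcongr
        _ = _ := by ring
    have hτ : 4 * ℓ ≤ a ^ 2 / (2 * v) := by
      rw [ha2, le_div_iff₀ (by positivity)]
      linarith
    have h6 := exceptional_prob_le hn1 hq0.le hJn hkq hA₁ hA₂ hτ
    refine h6.trans ?_
    rw [div_le_iff₀ hn0]
    have h7 : 6 / η ≤ n := hBη.trans hBn
    rw [div_le_iff₀ hη] at h7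
    linarith
  · have hregω := hreg ω hω
    refine ⟨fun b hb => (hregω.card_le b hb).trans (hM.trans_eq (by rw [hβ])), ?_⟩
    intro G θhat hG hθ
    have hℓr : ℓ ≤ ℓ ^ (3 / 2 + r) := by
      calc ℓ = ℓ ^ (1 : ℝ) := (Real.rpow_one ℓ).symm
        _ ≤ _ := Real.rpow_le_rpow_of_exponent_le hℓ (by linarith)
    have hpeneq : penalty r n = ℓ ^ (3 / 2 + r) := max_eq_right (hℓ.trans hℓr)
    have hlam := (ha ▸ required_penalty_le hℓ hNℓ hα0 hβ0 hm hM hJ2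
      (show 0 ≤ 8 * v by positivity)).trans
      (show pen ≤ penalty r n by rw [hpeneq]; exact hBpen.trans (hBℓ.trans hℓr))
    have hsum := sum_sq_sub_le_of_isRegularSample c.two_le_d hG (fun i => cellIndex_mem_box J _)
      hm0 (by positivity) ha0 hregω hlam hθ
    have hB2 : 4 * (a ^ 2 * n / (2 ^ (c.d * J) * (n * (lowerProb c / 2 ^ (c.d * J)) / 4)))
        = 128 * v / lowerProb c * ℓ := by
      rw [ha2]
      field_simp
      ring
    rw [hB2, hpeneq] at hsum
    have hTV := graphTV_nonneg G fun i => f₀ (x i ω)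
    have hfin : ∑ i, (θhat i - f₀ (x i ω)) ^ 2
        ≤ (128 * v / lowerProb c + 8) * (N + ℓ ^ (3 / 2 + r) * graphTV G fun i => f₀ (x i ω)) := by
      have h8 : 0 ≤ ℓ ^ (3 / 2 + r) * graphTV G fun i => f₀ (x i ω) := by positivity
      have h9 : 0 ≤ 128 * v / lowerProb c := by positivity
      have h10 := mul_le_mul_of_nonneg_left hNℓ h9
      have h11 := mul_nonneg h9 h8
      rw [mul_assoc 8] at hsum
      rw [add_mul, mul_add]
      linarith
    unfold empNormSq rate
    calc (n : ℝ)⁻¹ * ∑ i, (θhat i - f₀ (x i ω)) ^ 2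
        ≤ (n : ℝ)⁻¹ * ((128 * v / lowerProb c + 8)
          * (N + ℓ ^ (3 / 2 + r) * graphTV G fun i => f₀ (x i ω))) := by gcongr
      _ = _ := by rw [← hℓdef, ← hN]; ring

/-! ### The two nearest-neighbour graphs -/

/-- If a ball about `x j` contains at most `K` other sample points, they all are among the `K`
nearest neighbours of `x j`. -/
theorem mem_of_isNearestNeighborSet {X : Type*} [MetricSpace X] {n : ℕ} {x : Fin n → X} {K : ℕ}
    {j : Fin n} {S : Finset (Fin n)} (hS : IsNearestNeighborSet x K j S) {R : ℝ}
    (hR : (Finset.univ.filter fun l => l ≠ j ∧ dist (x l) (x j) ≤ R).card ≤ K) {i : Fin n}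
    (hij : i ≠ j) (hi : dist (x i) (x j) ≤ R) : i ∈ S := by
  obtain ⟨hj, hcard, hnear⟩ := hS
  by_contra hiS
  have hsub : insert i S ⊆ Finset.univ.filter fun l => l ≠ j ∧ dist (x l) (x j) ≤ R := by
    intro l hl
    rw [Finset.mem_filter]
    rcases Finset.mem_insert.1 hl with rfl | hl
    · exact ⟨Finset.mem_univ _, hij, hi⟩
    · exact ⟨Finset.mem_univ _, fun h => hj (h ▸ hl), (hnear l hl i hiS hij).trans hi⟩
  have h1 := Finset.card_le_card hsub
  rw [Finset.card_insert_of_notMem hiS] at h1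
  have h2 : (insert j (insert i S)).card ≤ n :=
    (Finset.card_le_univ _).trans_eq (Fintype.card_fin n)
  rw [Finset.card_insert_of_notMem (by simp [hij.symm, hj]),
    Finset.card_insert_of_notMem hiS] at h2
  omega

/-- Sample points in nearby cells are at distance at most `2 d 2⁻ᴶ / Lmin`. -/
theorem dist_le_of_nearby_cells {c : Constants} {X : Type*} [MetricSpace X]
    {h : X ≃ₜ unitCube c.d}
    (hh : ∀ t t' : X, c.Lmin * dist t t' ≤ ‖(h t : EuclideanSpace ℝ (Fin c.d)) - h t'‖ ∧
      ‖(h t : EuclideanSpace ℝ (Fin c.d)) - h t'‖ ≤ c.Lmax * dist t t') (J : ℕ) {t t' : X}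
    (hn : ∀ k, cellIndex J (h t).1 k ≤ cellIndex J (h t').1 k + 1 ∧
      cellIndex J (h t').1 k ≤ cellIndex J (h t).1 k + 1) :
    dist t t' ≤ 2 * c.d * (1 / 2) ^ J / c.Lmin := by
  rw [le_div_iff₀ c.Lmin_pos, mul_comm]
  refine ((hh t t').1.trans (norm_sub_le_of_nearby_cells J (h t).2 (h t').2 hn)).trans_eq ?_
  ring

/-- The number of cells, in each direction, that a ball of radius `2 d 2⁻ᴶ / Lmin` can reach. -/
noncomputable def reach (c : Constants) : ℕ := ⌈2 * c.d * c.Lmax / c.Lmin + 1⌉₊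

/-- The `K`-nearest-neighbour graph joins nearby cells if the cells hold few points. -/
theorem joinsNearbyCells_of_isKNNGraph {c : Constants} {X : Type*} [MetricSpace X]
    {h : X ≃ₜ unitCube c.d}
    (hh : ∀ t t' : X, c.Lmin * dist t t' ≤ ‖(h t : EuclideanSpace ℝ (Fin c.d)) - h t'‖ ∧
      ‖(h t : EuclideanSpace ℝ (Fin c.d)) - h t'‖ ≤ c.Lmax * dist t t') {J n K : ℕ}
    {x : Fin n → X} {G : SimpleGraph (Fin n)} (hG : IsKNNGraph x K G) {M : ℝ} (hM0 : 0 ≤ M)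
    (hM : ∀ b ∈ box (fun _ => 2 ^ J),
      ((Finset.univ.filter (sampleCell h J x · = b)).card : ℝ) ≤ M)
    (hK : (2 * reach c + 1) ^ c.d * M ≤ K) : JoinsNearbyCells G (sampleCell h J x) := by
  obtain ⟨S, hS, hadj⟩ := hG
  intro i j hij hnear
  refine (hadj i j).2 (Or.inl ?_)
  refine mem_of_isNearestNeighborSet (hS j) ?_ hij (dist_le_of_nearby_cells hh J hnear)
  have hM' : ∀ b, ((Finset.univ.filter (sampleCell h J x · = b)).card : ℝ) ≤ M := by
    intro b
    by_cases hb : b ∈ box fun _ => 2 ^ J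
    · exact hM b hb
    · have : Finset.univ.filter (sampleCell h J x · = b) = ∅ := by
        rw [Finset.filter_eq_empty_iff]
        intro l _ hl
        exact hb (hl ▸ cellIndex_mem_box J _)
      simpa [this] using hM0
  have hLmax := c.Lmax_pos
  have hreach : ∀ t t' : X, dist t t' ≤ 2 * c.d * (1 / 2) ^ J / c.Lmin →
      ∀ k, cellIndex J (h t).1 k ≤ cellIndex J (h t').1 k + reach c := by
    intro t t' htt'
    refine cellIndex_le_of_norm_sub_le J (h t).2 (h t').2 (le_trans ?_ (Nat.le_ceil _))
    gcongr
    calc _ ≤ (c.Lmax * (2 * c.d * (1 / 2) ^ J / c.Lmin)) * 2 ^ J := by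
          gcongr
          exact (hh t t').2.trans (by gcongr)
      _ = _ := by
          rw [one_div_pow]
          field_simp
  have hcard := card_filter_window_le (sampleCell h J x) hM' (reach c) (sampleCell h J x j)
    (Finset.univ.filter fun l => l ≠ j ∧ dist (x l) (x j) ≤ 2 * c.d * (1 / 2) ^ J / c.Lmin)
    fun l hl k => by
      have hl' := (Finset.mem_filter.1 hl).2.2
      exact ⟨hreach _ _ hl' k, hreach _ _ (by rwa [dist_comm]) k⟩
  exact_mod_cast hcard.trans hK

end KNNFusedLasso

theorem theorem3p1 (c : KNNFusedLasso.Constants) (r : ℝ) (hr : 0 < r) :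
    -- the `K`-NN fused lasso
    (∀ K : ℕ → ℕ, (fun n => (K n : ℝ)) =Θ[atTop] (fun n : ℕ => Real.log n ^ (1 + 2 * r)) →
      ∃ lam : ℕ → ℝ, (∀ n, 0 < lam n) ∧
        ∀ η : ℝ, 0 < η → ∃ M : ℝ, 0 < M ∧ ∃ n₀ : ℕ, ∀ n : ℕ, n₀ ≤ n →
          ∀ (X : Type*) [MetricSpace X] [MeasurableSpace X] [BorelSpace X]
            (μ : Measure X) (p : X → ℝ) (f₀ : X → ℝ)
            (Ω : Type*) [MeasurableSpace Ω] (P : Measure Ω) [IsProbabilityMeasure P]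
            (x : Fin n → Ω → X) (ξ : Fin n → Ω → ℝ),
            KNNFusedLasso.DesignAssumptions c μ p →
            KNNFusedLasso.SampleAssumptions c μ p P x ξ →
            P {ω | ∃ (G : SimpleGraph (Fin n)) (θhat : Fin n → ℝ),
                KNNFusedLasso.IsKNNGraph (fun i => x i ω) (K n) G ∧
                KNNFusedLasso.IsFusedLasso (fun i => f₀ (x i ω) + ξ i ω) G (lam n) θhat ∧
                M * KNNFusedLasso.rate r n (KNNFusedLasso.graphTV G (fun i => f₀ (x i ω)))
                  < KNNFusedLasso.empNormSq (fun i => θhat i - f₀ (x i ω))}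
              ≤ ENNReal.ofReal η) ∧
    -- the `ε`-NN fused lasso
    (∀ ε : ℕ → ℝ,
      (∃ a : ℝ, 0 < a ∧ ∀ᶠ n : ℕ in atTop,
        a * (Real.log n ^ (1 + 2 * r) / n) ^ (1 / (c.d : ℝ)) ≤ ε n) →
      ∃ lam : ℕ → ℝ, (∀ n, 0 < lam n) ∧
        ∀ η : ℝ, 0 < η → ∃ M : ℝ, 0 < M ∧ ∃ n₀ : ℕ, ∀ n : ℕ, n₀ ≤ n →
          ∀ (X : Type*) [MetricSpace X] [MeasurableSpace X] [BorelSpace X]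
            (μ : Measure X) (p : X → ℝ) (f₀ : X → ℝ)
            (Ω : Type*) [MeasurableSpace Ω] (P : Measure Ω) [IsProbabilityMeasure P]
            (x : Fin n → Ω → X) (ξ : Fin n → Ω → ℝ),
            KNNFusedLasso.DesignAssumptions c μ p →
            KNNFusedLasso.SampleAssumptions c μ p P x ξ →
            P {ω | ∃ θhat : Fin n → ℝ,
                KNNFusedLasso.IsFusedLasso (fun i => f₀ (x i ω) + ξ i ω)
                  (KNNFusedLasso.epsGraph (fun i => x i ω) (ε n)) (lam n) θhat ∧
                M * KNNFusedLasso.rate r n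
                    (KNNFusedLasso.graphTV (KNNFusedLasso.epsGraph (fun i => x i ω) (ε n))
                      (fun i => f₀ (x i ω)))
                  < KNNFusedLasso.empNormSq (fun i => θhat i - f₀ (x i ω))}
              ≤ ENNReal.ofReal η) := by
  have hLmin := c.Lmin_pos
  have hup := KNNFusedLasso.upperProb_pos c
  have hd : 0 < c.d := lt_of_lt_of_le two_pos c.two_le_d
  have hdR : (0 : ℝ) < c.d := by exact_mod_cast hd
  constructor
  · intro K hK
    obtain ⟨b, hb, hKb⟩ := hK.2.exists_pos
    -- the cells are so small that a ball that covers the nearby cells holds at most `K` points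
    set κ : ℝ :=
      b⁻¹ / (3 * KNNFusedLasso.upperProb c * (2 * KNNFusedLasso.reach c + 1) ^ c.d) with hκ
    have hκ0 : 0 < κ := by positivity
    obtain ⟨M, hM, hrate⟩ := KNNFusedLasso.exists_rate_bound c hr hκ0
    refine ⟨KNNFusedLasso.penalty r, KNNFusedLasso.penalty_pos r, fun η hη => ⟨M, hM, ?_⟩⟩
    obtain ⟨n₀, hn₀⟩ := eventually_atTop.1 ((hrate η hη).and hKb.bound)
    refine ⟨n₀, fun n hn X _ _ _ μ p f₀ Ω _ P _ x ξ hD hS => ?_⟩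
    obtain ⟨⟨J, hℓ, -, hJ⟩, hKn⟩ := hn₀ n hn
    obtain ⟨h, hh⟩ := hD.exists_homeomorph
    obtain ⟨Bad, hBad, hgood⟩ := hJ X μ p f₀ Ω P x ξ hD hS h hh
    refine (measure_mono ?_).trans hBad
    rintro ω ⟨G, θhat, hG, hθ, hlt⟩
    by_contra hω
    obtain ⟨hcount, hbound⟩ := hgood ω hω
    have hN : 0 ≤ Real.log n ^ (1 + 2 * r) := by positivity
    refine hlt.not_ge (hbound G θhat
      (KNNFusedLasso.joinsNearbyCells_of_isKNNGraph hh hG (by positivity)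
      hcount ?_) hθ)
    rw [Real.norm_of_nonneg hN, Real.norm_of_nonneg (Nat.cast_nonneg _)] at hKn
    calc _ = b⁻¹ * Real.log n ^ (1 + 2 * r) := by
          rw [hκ]
          field_simp
      _ ≤ K n := by
          rw [inv_mul_le_iff₀ hb]
          exact hKn
  · rintro ε ⟨a, ha, hε⟩
    -- the cells are so small that points in nearby cells are at distance less than `ε`
    set κ : ℝ := (a * c.Lmin / (4 * c.d)) ^ c.d with hκ
    have hκ0 : 0 < κ := by positivity
    obtain ⟨M, hM, hrate⟩ := KNNFusedLasso.exists_rate_bound c hr hκ0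
    refine ⟨KNNFusedLasso.penalty r, KNNFusedLasso.penalty_pos r, fun η hη => ⟨M, hM, ?_⟩⟩
    obtain ⟨n₀, hn₀⟩ := eventually_atTop.1 (((hrate η hη).and hε).and (eventually_ge_atTop 1))
    refine ⟨n₀, fun n hn X _ _ _ μ p f₀ Ω _ P _ x ξ hD hS => ?_⟩
    obtain ⟨⟨⟨J, hℓ, hscale, hJ⟩, hεn⟩, hn1⟩ := hn₀ n hn
    obtain ⟨h, hh⟩ := hD.exists_homeomorph
    obtain ⟨Bad, hBad, hgood⟩ := hJ X μ p f₀ Ω P x ξ hD hS h hh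
    refine (measure_mono ?_).trans hBad
    rintro ω ⟨θhat, hθ, hlt⟩
    by_contra hω
    refine hlt.not_ge ((hgood ω hω).2 _ θhat (fun i j hij hnear => ⟨hij, ?_⟩) hθ)
    refine (KNNFusedLasso.dist_le_of_nearby_cells hh J hnear).trans_lt (lt_of_lt_of_le ?_ hεn)
    have hn0 : (0 : ℝ) < n := by exact_mod_cast hn1
    have hN : 0 < Real.log n ^ (1 + 2 * r) := Real.rpow_pos_of_pos (by linarith) _
    set t := (Real.log n ^ (1 + 2 * r) / n) ^ (1 / (c.d : ℝ)) with ht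
    have ht0 : 0 < t := by positivity
    have htd : t ^ c.d = Real.log n ^ (1 + 2 * r) / n := by
      rw [ht, one_div, Real.rpow_inv_natCast_pow (by positivity) hd.ne']
    have hw : (1 / 2 : ℝ) ^ J ≤ a * c.Lmin / (4 * c.d) * t := by
      refine le_of_pow_le_pow_left₀ hd.ne' (by positivity) ?_
      rw [mul_pow, ← hκ, htd, ← pow_mul, mul_comm J c.d, one_div_pow,
        div_le_iff₀ (by positivity)]
      rw [div_le_iff₀ (by positivity)] at hscale
      rw [mul_div_assoc', div_mul_eq_mul_div, le_div_iff₀ hn0]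
      linarith
    calc 2 * c.d * (1 / 2) ^ J / c.Lmin ≤ 2 * c.d * (a * c.Lmin / (4 * c.d) * t) / c.Lmin := by
          gcongr
      _ = a * t / 2 := by
          field_simp
          ring
      _ < a * t := half_lt_self (by positivity)
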